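/- All manifolds and vector bundles are smooth, real and of finite dimension (rank). A Lie algebroid over a manifold $M$ is a vector bundle $A\to M$ with a vector bundle morphism $\rho\colon A\to TM$ over the identity (the anchor) and an $\mathbb R$-bilinear Lie bracket on the space $\Gamma(A)$ of smooth sections such that $[a,fb]=f[a,b]+\rho(a)(f)\,b$ for all $a,b\in\Gamma(A)$ and $f\in C^\infty(M)$. It is transitive if $\rho$ is fibrewise surjective. For $x\in M$ the fibre $K_x=\ker(\rho_x\colon A_x\to T_xM)$ of the kernel $K$ of $\rho$ is a Lie algebra with the bracket $[a(x),b(x)]:=[a,b](x)$ for $a,b\in\Gamma(A)$ with $a(x),b(x)\in K_x$. Theorem. Let $A\to M$ be a transitive Lie algebroid with anchor $\rho$, and assume that $M$ is connected. Then the kernel $K$ of $\rho$ is a Lie algebra bundle: $K$ is a smooth vector bundle over $M$, smoothly and topologically embedded in $A$ by the inclusion, and there is a Lie algebra $\mathfrak g$ such that every point of $M$ has an open neighbourhood $U$ with a diffeomorphism $K|_U\to U\times\mathfrak g$ over $U$ that restricts to an isomorphism of Lie algebras $K_y\to\mathfrak g$ for every $y\in U$. In particular, the Lie algebras $K_x$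 and $K_y$ are isomorphic for all $x,y\in M$. -/

import Mathlib

open scoped Manifold ContDiff Bundle Topology
open Bundle

noncomputable section

universe uF

section LieAlgebroid

variable {E : Type*} [NormedAddCommGroup E] [NormedSpace ℝ E]
  {H : Type*} [TopologicalSpace H] (I : ModelWithCorners ℝ E H)
  {M : Type*} [TopologicalSpace M] [ChartedSpace H M]
  (F : Type*) [NormedAddCommGroup F] [NormedSpace ℝ F]
  (A : M → Type*) [∀ x, AddCommGroup (A x)] [∀ x, Module ℝ (A x)]
  [∀ x, TopologicalSpace (A x)] [TopologicalSpace (TotalSpace F A)]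
  [FiberBundle F A] [VectorBundle ℝ F A]

variable {F A} in
/-- The smooth section `f • a` of `A`, for a smooth function `f` and a smooth section `a`. -/
def funSmul (f : C^∞⟮I, M; ℝ⟯) (a : Cₛ^∞⟮I; F, A⟯) : Cₛ^∞⟮I; F, A⟯ where
  toFun x := f x • a x
  contMDiff_toFun := f.contMDiff.smul_section a.contMDiff

/-- The derivative `v(f) = df(v)` of a real function `f` along a tangent vector `v`. -/
def dirDeriv (f : M → ℝ) {x : M} (v : TangentSpace I x) : ℝ :=
  mfderiv I 𝓘(ℝ, ℝ) f x v

/-- A Lie algebroid structure on the smooth real vector bundle `A → M`: a smooth vector bundle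
morphism `ρ : A → TM` over the identity (the anchor) and a Lie bracket on the space `Γ(A)` of
smooth sections, with the Leibniz rule `[a, f b] = f [a, b] + ρ(a)(f) b`. That `ρ` then maps
brackets to brackets of vector fields is a consequence, and is not required. -/
structure LieAlgebroid [IsManifold I 1 M] where
  /-- the anchor, fibre by fibre -/
  anchor : ∀ x : M, A x →ₗ[ℝ] TangentSpace I x
  /-- the anchor is smooth as a map `A → TM` of total spaces -/
  contMDiff_anchor : ContMDiff (I.prod 𝓘(ℝ, F)) I.tangent ∞
    (fun v : TotalSpace F A => (⟨v.proj, anchor v.proj v.2⟩ : TangentBundle I M))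
  /-- the bracket of smooth sections -/
  bracket : Cₛ^∞⟮I; F, A⟯ →ₗ[ℝ] Cₛ^∞⟮I; F, A⟯ →ₗ[ℝ] Cₛ^∞⟮I; F, A⟯
  bracket_self : ∀ a, bracket a a = 0
  jacobi : ∀ a b c,
    bracket a (bracket b c) = bracket (bracket a b) c + bracket b (bracket a c)
  leibniz : ∀ (a b : Cₛ^∞⟮I; F, A⟯) (f : C^∞⟮I, M; ℝ⟯) (x : M),
    bracket a (funSmul I f b) x
      = f x • bracket a b x + dirDeriv I f (anchor x (a x)) • b x

end LieAlgebroid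

section Sections

variable {E : Type*} [NormedAddCommGroup E] [NormedSpace ℝ E]
  {H : Type*} [TopologicalSpace H] {I : ModelWithCorners ℝ E H}
  {M : Type*} [TopologicalSpace M] [ChartedSpace H M]
  {F : Type*} [NormedAddCommGroup F] [NormedSpace ℝ F]
  {A : M → Type*} [∀ x, AddCommGroup (A x)] [∀ x, Module ℝ (A x)]
  [∀ x, TopologicalSpace (A x)] [TopologicalSpace (TotalSpace F A)]
  [FiberBundle F A] [VectorBundle ℝ F A]

/-- A tangent vector that annihilates all smooth functions is zero. -/
theorem eq_zero_of_dirDeriv [FiniteDimensional ℝ E] [T2Space M] [IsManifold I ∞ M]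
    {x : M} (v : TangentSpace I x)
    (h : ∀ f : C^∞⟮I, M; ℝ⟯, dirDeriv I f v = 0) : v = 0 := by
  obtain ⟨ψ⟩ : Nonempty (SmoothBumpFunction I x) := inferInstance
  have hg : ContMDiff I 𝓘(ℝ, E) ∞ (fun y => ψ y • extChartAt I x y) :=
    ψ.contMDiff_smul contMDiffOn_extChartAt
  set D := mfderiv I 𝓘(ℝ, E) (extChartAt I x) x with hD
  have hinv : D.IsInvertible := isInvertible_mfderiv_extChartAt (mem_extChartAt_source x)
  have hDg : mfderiv I 𝓘(ℝ, E) (fun y => ψ y • extChartAt I x y) x = D := by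
    apply Filter.EventuallyEq.mfderiv_eq
    filter_upwards [ψ.eventuallyEq_one] with y hy
    simp [hy]
  have key : ∀ ℓ : E →L[ℝ] ℝ, ℓ (D v) = 0 := by
    intro ℓ
    have hf : ContMDiff I 𝓘(ℝ, ℝ) ∞ (fun y => ℓ (ψ y • extChartAt I x y)) :=
      ℓ.contMDiff.comp hg
    have := h ⟨_, hf⟩
    have hc : mfderiv I 𝓘(ℝ, ℝ) (ℓ ∘ (fun y => ψ y • extChartAt I x y)) x
        = (mfderiv 𝓘(ℝ, E) 𝓘(ℝ, ℝ) ℓ (ψ x • extChartAt I x x)).comp D := by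
      rw [← hDg]
      exact mfderiv_comp x ℓ.mdifferentiableAt (hg.mdifferentiable (by simp) x)
    rw [ContinuousLinearMap.mfderiv_eq] at hc
    have h2 : dirDeriv I (ℓ ∘ (fun y => ψ y • extChartAt I x y)) v = ℓ (D v) := by
      unfold dirDeriv
      rw [hc]
      rfl
    exact h2.symm.trans this
  have hDv : D v = 0 := by
    by_contra hne
    have hne' : @id E (D v) ≠ 0 := hne
    obtain ⟨ℓ, hℓ⟩ := SeparatingDual.exists_ne_zero (R := ℝ) hne'
    exact hℓ (key ℓ)
  exact hinv.injective (hDv.trans (map_zero D).symm)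

/-- Every vector of a vector bundle is the value of a global smooth section. -/
theorem exists_section [FiniteDimensional ℝ E] [T2Space M] [IsManifold I ∞ M]
    [ContMDiffVectorBundle ∞ F A I] (x : M) (v : A x) :
    ∃ s : Cₛ^∞⟮I; F, A⟯, s x = v := by
  let t := trivializationAt F A x
  have hx : x ∈ t.baseSet := FiberBundle.mem_baseSet_trivializationAt F A x
  obtain ⟨ψ, hψ, -⟩ := (SmoothBumpFunction.nhds_basis_support (I := I)
    (t.open_baseSet.mem_nhds hx)).mem_iff.1 (t.open_baseSet.mem_nhds hx)
  have hs : ContMDiffOn I (I.prod 𝓘(ℝ, F)) ∞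
      (fun y => TotalSpace.mk' F y (t.symm y (t ⟨x, v⟩).2)) t.baseSet := by
    rw [t.contMDiffOn_section_baseSet_iff]
    refine (contMDiffOn_const (c := (t ⟨x, v⟩).2)).congr fun y hy => ?_
    rw [t.apply_mk_symm hy]
  refine ⟨⟨_, ContMDiffOn.smul_section_of_tsupport ψ.contMDiff.contMDiffOn t.open_baseSet hψ hs⟩, ?_⟩
  show ψ x • t.symm x (t ⟨x, v⟩).2 = v
  rw [ψ.eq_one, one_smul]
  exact t.symm_apply_apply_mk hx v

end Sections

set_option linter.unusedSectionVars false

namespace LieAlgebroid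

variable {E : Type*} [NormedAddCommGroup E] [NormedSpace ℝ E]
  {H : Type*} [TopologicalSpace H] {I : ModelWithCorners ℝ E H}
  {M : Type*} [TopologicalSpace M] [ChartedSpace H M]
  {F : Type*} [NormedAddCommGroup F] [NormedSpace ℝ F]
  {A : M → Type*} [∀ x, AddCommGroup (A x)] [∀ x, Module ℝ (A x)]
  [∀ x, TopologicalSpace (A x)] [TopologicalSpace (TotalSpace F A)]
  [FiberBundle F A] [VectorBundle ℝ F A]

section Basic

variable [IsManifold I 1 M] (L : LieAlgebroid I F A)

/-- A Lie algebroid is transitive if its anchor is fibrewise surjective. -/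
def IsTransitive : Prop := ∀ x, Function.Surjective (L.anchor x)

/-- The fibre `K_x = ker (ρ_x : A_x → T_x M)` of the kernel of the anchor, with the vector space
structure and the topology of a subspace of `A_x`. -/
def kernel (x : M) : Submodule ℝ (A x) := LinearMap.ker (L.anchor x)

theorem bracket_swap (a b : Cₛ^∞⟮I; F, A⟯) : L.bracket a b = -L.bracket b a := by
  have h := L.bracket_self (a + b)
  simp only [map_add, LinearMap.add_apply, L.bracket_self, zero_add, add_zero] at h
  rw [add_comm] at h
  exact eq_neg_of_add_eq_zero_left h

end Basic

variable [FiniteDimensional ℝ E] [T2Space M] [IsManifold I ∞ M]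
  [ContMDiffVectorBundle ∞ F A I] (L : LieAlgebroid I F A)

/-- The smooth function `ρ(a)(f)`. -/
def anchorDeriv (a : Cₛ^∞⟮I; F, A⟯) (f : C^∞⟮I, M; ℝ⟯) : C^∞⟮I, M; ℝ⟯ :=
  ⟨fun x => dirDeriv I f (L.anchor x (a x)), by
    have h1 : ContMDiff I I.tangent ∞
        (fun x => (⟨x, L.anchor x (a x)⟩ : TangentBundle I M)) :=
      L.contMDiff_anchor.comp a.contMDiff
    have h2 : ContMDiff I.tangent 𝓘(ℝ, ℝ).tangent ∞ (tangentMap I 𝓘(ℝ, ℝ) f) :=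
      f.contMDiff.contMDiff_tangentMap (by simp)
    exact (contMDiff_snd_tangentBundle_modelSpace ℝ 𝓘(ℝ, ℝ)).comp (h2.comp h1)⟩

/-- `ρ([a, b])(f) c = (ρ(a)(ρ(b)(f)) - ρ(b)(ρ(a)(f))) c` for all sections `c`. -/
theorem dirDeriv_anchor_bracket (a b c : Cₛ^∞⟮I; F, A⟯) (f : C^∞⟮I, M; ℝ⟯) (x : M) :
    dirDeriv I f (L.anchor x (L.bracket a b x)) • c x
      = (dirDeriv I (L.anchorDeriv b f) (L.anchor x (a x))
          - dirDeriv I (L.anchorDeriv a f) (L.anchor x (b x))) • c x := by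
  have key : ∀ a b : Cₛ^∞⟮I; F, A⟯, L.bracket a (L.bracket b (funSmul I f c)) x
      = f x • L.bracket a (L.bracket b c) x
        + dirDeriv I f (L.anchor x (a x)) • L.bracket b c x
        + (dirDeriv I f (L.anchor x (b x)) • L.bracket a c x
        + dirDeriv I (L.anchorDeriv b f) (L.anchor x (a x)) • c x) := by
    intro a b
    have h : L.bracket b (funSmul I f c)
        = funSmul I f (L.bracket b c) + funSmul I (L.anchorDeriv b f) c := by
      ext y
      exact L.leibniz b c f y
    rw [h, map_add]
    show L.bracket a _ x + L.bracket a _ x = _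
    rw [L.leibniz, L.leibniz]
    rfl
  have hj := congrArg (fun s : Cₛ^∞⟮I; F, A⟯ => s x) (L.jacobi a b (funSmul I f c))
  have hj0 := congrArg (fun s : Cₛ^∞⟮I; F, A⟯ => s x) (L.jacobi a b c)
  simp only [ContMDiffSection.coe_add, Pi.add_apply] at hj hj0
  rw [key a b, key b a, L.leibniz, hj0] at hj
  rw [sub_smul, eq_sub_iff_add_eq]
  rw [smul_add] at hj
  rw [← sub_eq_zero] at hj ⊢
  rw [← neg_eq_zero, ← hj]
  abel

/-- If `a` and `b` have values in the kernel of the anchor at `x`, so has `[a, b]`. -/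
theorem bracket_mem_kernel {a b : Cₛ^∞⟮I; F, A⟯} {x : M} (ha : a x ∈ L.kernel x)
    (hb : b x ∈ L.kernel x) : L.bracket a b x ∈ L.kernel x := by
  by_cases h0 : L.bracket a b x = 0
  · rw [h0]; exact zero_mem _
  refine LinearMap.mem_ker.2 (eq_zero_of_dirDeriv _ fun f => ?_)
  have h := L.dirDeriv_anchor_bracket a b (L.bracket a b) f x
  rw [LinearMap.mem_ker.1 ha, LinearMap.mem_ker.1 hb] at h
  have hz : ∀ g : M → ℝ, dirDeriv I g (0 : TangentSpace I x) = 0 := fun g => map_zero _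
  rw [hz, hz, sub_zero, zero_smul] at h
  exact (smul_eq_zero.1 h).resolve_right h0

/-- If `a(x)` lies in the kernel of the anchor and `b(x) = 0`, then `[a, b](x) = 0`. -/
theorem bracket_eq_zero_of_right [FiniteDimensional ℝ F] {a b : Cₛ^∞⟮I; F, A⟯} {x : M}
    (ha : a x ∈ L.kernel x) (hb : b x = 0) : L.bracket a b x = 0 := by
  classical
  have hz : ∀ g : M → ℝ, dirDeriv I g (0 : TangentSpace I x) = 0 := fun g => map_zero _
  have hlin : ∀ (f : C^∞⟮I, M; ℝ⟯) (c : Cₛ^∞⟮I; F, A⟯),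
      L.bracket a (funSmul I f c) x = f x • L.bracket a c x := by
    intro f c
    rw [L.leibniz, LinearMap.mem_ker.1 ha, hz, zero_smul, add_zero]
  let t := trivializationAt F A x
  have hx : x ∈ t.baseSet := FiberBundle.mem_baseSet_trivializationAt F A x
  obtain ⟨ψ, hψ, -⟩ := (SmoothBumpFunction.nhds_basis_support (I := I)
    (t.open_baseSet.mem_nhds hx)).mem_iff.1 (t.open_baseSet.mem_nhds hx)
  let β := Module.finBasis ℝ F
  have : ContMDiffVectorBundle 1 F A I := ContMDiffVectorBundle.of_le (n := ∞) (by simp)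
  let s : Fin (Module.finrank ℝ F) → Cₛ^∞⟮I; F, A⟯ := fun i =>
    ⟨_, ContMDiffOn.smul_section_of_tsupport ψ.contMDiff.contMDiffOn t.open_baseSet hψ
      (t.contMDiffOn_localFrame_baseSet (I := I) ∞ β i)⟩
  let c : Fin (Module.finrank ℝ F) → C^∞⟮I, M; ℝ⟯ := fun i =>
    ⟨fun y => ψ y • t.localFrameCoeff I β i y (b y), by
      refine contMDiff_of_tsupport fun y hy => ?_
      have hy' : y ∈ t.baseSet := hψ (tsupport_smul_subset_left _ _ hy)
      exact ψ.contMDiffAt.smul (contMDiffAt_localFrameCoeff β hy' b.contMDiff.contMDiffAt i)⟩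
  let ψ' : C^∞⟮I, M; ℝ⟯ := ⟨ψ, ψ.contMDiff⟩
  have hsum : funSmul I ψ' (funSmul I ψ' b) = ∑ i, funSmul I (c i) (s i) := by
    ext y
    have hR : (∑ i, funSmul I (c i) (s i)) y = ∑ i, funSmul I (c i) (s i) y :=
      (congrFun (map_sum (ContMDiffSection.coeAddHom I F ∞ A) _ _) y).trans
        (Finset.sum_apply _ _ _)
    rw [hR]
    show ψ y • ψ y • b y
      = ∑ i, (ψ y • t.localFrameCoeff I β i y (b y)) • (ψ y • t.localFrame β i y)
    by_cases hy : y ∈ t.baseSet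
    · conv_lhs => rw [t.eq_sum_localFrameCoeff_smul (I := I) (b := β) (s := fun y => b y) hy]
      rw [Finset.smul_sum, Finset.smul_sum]
      refine Finset.sum_congr rfl fun i _ => ?_
      simp only [smul_smul, smul_eq_mul]
      congr 1
      ring
    · have : ψ y = 0 := image_eq_zero_of_notMem_tsupport fun h => hy (hψ h)
      simp [this]
  have h1 : L.bracket a (funSmul I ψ' (funSmul I ψ' b)) x = L.bracket a b x := by
    rw [hlin, hlin]
    show ψ x • ψ x • _ = _
    rw [ψ.eq_one, one_smul, one_smul]
  rw [← h1, hsum, map_sum]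
  have hR : (∑ i, L.bracket a (funSmul I (c i) (s i))) x
      = ∑ i, L.bracket a (funSmul I (c i) (s i)) x :=
    (congrFun (map_sum (ContMDiffSection.coeAddHom I F ∞ A) _ _) x).trans
      (Finset.sum_apply _ _ _)
  rw [hR]
  refine Finset.sum_eq_zero fun i _ => ?_
  rw [hlin]
  show (ψ x • t.localFrameCoeff I β i x (b x)) • _ = _
  rw [hb, map_zero, smul_zero, zero_smul]

/-- A global smooth section with value `v` at `x`. -/
def extend {x : M} (v : A x) : Cₛ^∞⟮I; F, A⟯ := (exists_section (I := I) (F := F) x v).choose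

theorem extend_apply {x : M} (v : A x) : (extend v : Cₛ^∞⟮I; F, A⟯) x = v :=
  (exists_section (I := I) (F := F) x v).choose_spec

variable [FiniteDimensional ℝ F]

/-- On the kernel of the anchor the bracket is pointwise. -/
theorem bracket_congr {a b a' b' : Cₛ^∞⟮I; F, A⟯} {x : M} (ha : a x ∈ L.kernel x)
    (hb : b x ∈ L.kernel x) (haa : a x = a' x) (hbb : b x = b' x) :
    L.bracket a b x = L.bracket a' b' x := by
  have h1 : L.bracket a (b - b') x = 0 :=
    L.bracket_eq_zero_of_right ha (by simp [hbb])
  have h2 : L.bracket b' (a - a') x = 0 :=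
    L.bracket_eq_zero_of_right (hbb ▸ hb) (by simp [haa])
  rw [map_sub, ContMDiffSection.coe_sub, Pi.sub_apply, sub_eq_zero] at h1 h2
  rw [h1, L.bracket_swap a b', L.bracket_swap a' b']
  simp only [ContMDiffSection.coe_neg, Pi.neg_apply, h2]

/-- The bracket on the fibre `K_x` of the kernel of the anchor:
`[a(x), b(x)] = [a, b](x)` for any smooth sections `a`, `b` of `A` with values in `K_x` at `x`;
see `kernel_bracket`. -/
instance kernelBracket (x : M) : Bracket (L.kernel x) (L.kernel x) where
  bracket v w := ⟨L.bracket (extend (v : A x)) (extend (w : A x)) x,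
    L.bracket_mem_kernel (by rw [extend_apply]; exact v.2) (by rw [extend_apply]; exact w.2)⟩

theorem kernel_bracket {x : M} (v w : L.kernel x) (a b : Cₛ^∞⟮I; F, A⟯)
    (ha : a x = v) (hb : b x = w) : ((⁅v, w⁆ : L.kernel x) : A x) = L.bracket a b x := by
  refine L.bracket_congr ?_ ?_ ?_ ?_
  · rw [extend_apply]; exact v.2
  · rw [extend_apply]; exact w.2
  · rw [extend_apply, ha]
  · rw [extend_apply, hb]

/-- The fibres of the kernel of the anchor are Lie algebras. -/
instance kernelLieRing (x : M) : LieRing (L.kernel x) where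
  add_lie u v w := by
    apply Subtype.ext
    rw [Submodule.coe_add,
      L.kernel_bracket (u + v) w (extend (u : A x) + extend (v : A x)) (extend (w : A x))
        (by simp [extend_apply]) (extend_apply _),
      L.kernel_bracket u w _ _ (extend_apply _) (extend_apply _),
      L.kernel_bracket v w _ _ (extend_apply _) (extend_apply _), map_add]
    rfl
  lie_add u v w := by
    apply Subtype.ext
    rw [Submodule.coe_add,
      L.kernel_bracket u (v + w) (extend (u : A x)) (extend (v : A x) + extend (w : A x))
        (extend_apply _) (by simp [extend_apply]),
      L.kernel_bracket u w _ _ (extend_apply _) (extend_apply _),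
      L.kernel_bracket u v _ _ (extend_apply _) (extend_apply _), map_add]
    rfl
  lie_self u := by
    apply Subtype.ext
    rw [L.kernel_bracket u u _ _ (extend_apply _) (extend_apply _), L.bracket_self]
    rfl
  leibniz_lie u v w := by
    have h : ∀ p q : L.kernel x, (L.bracket (extend (p : A x)) (extend (q : A x))) x
        = ((⁅p, q⁆ : L.kernel x) : A x) :=
      fun p q => (L.kernel_bracket p q _ _ (extend_apply _) (extend_apply _)).symm
    apply Subtype.ext
    rw [Submodule.coe_add,
      L.kernel_bracket u ⁅v, w⁆ _ _ (extend_apply _) (h v w),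
      L.kernel_bracket ⁅u, v⁆ w _ _ (h u v) (extend_apply _),
      L.kernel_bracket v ⁅u, w⁆ _ _ (extend_apply _) (h u w), L.jacobi]
    rfl

instance kernelLieAlgebra (x : M) : LieAlgebra ℝ (L.kernel x) where
  lie_smul r v w := by
    apply Subtype.ext
    rw [Submodule.coe_smul,
      L.kernel_bracket v (r • w) (extend (v : A x)) (r • extend (w : A x))
        (extend_apply _) (by simp [extend_apply]),
      L.kernel_bracket v w _ _ (extend_apply _) (extend_apply _), map_smul]
    rfl

/-- The inclusion `K → A` of total spaces, for a model fibre `F'` of `K`. -/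
def kernelIncl (F' : Type*) (k : TotalSpace F' (fun x => L.kernel x)) : TotalSpace F A :=
  ⟨k.proj, (k.2 : A k.proj)⟩

end LieAlgebroid

/-- A smooth Lie algebra bundle over `M`: a smooth vector bundle `V → M` with a Lie bracket on each
fibre, such that for some Lie algebra `𝔤` there are around each point of `M` a smooth local
trivialization `V|_U ≅ U × F`, and a linear isomorphism `F ≅ 𝔤`, for which the composite
`V|_U ≅ U × 𝔤` is an isomorphism of Lie algebras in each fibre. A local trivialization is smooth
if it is a diffeomorphism from `V|_U` onto `U × F`. -/
structure IsLieAlgebraBundle {E : Type*} [NormedAddCommGroup E] [NormedSpace ℝ E]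
    {H : Type*} [TopologicalSpace H] (I : ModelWithCorners ℝ E H)
    {M : Type*} [TopologicalSpace M] [ChartedSpace H M]
    (F : Type uF) [NormedAddCommGroup F] [NormedSpace ℝ F]
    (V : M → Type*) [∀ x, LieRing (V x)] [∀ x, LieAlgebra ℝ (V x)]
    [∀ x, TopologicalSpace (V x)] [TopologicalSpace (TotalSpace F V)]
    [FiberBundle F V] [VectorBundle ℝ F V] : Prop where
  contMDiffVectorBundle : ContMDiffVectorBundle ∞ F V I
  exists_trivialization : ∃ (𝔤 : Type uF) (_ : LieRing 𝔤) (_ : LieAlgebra ℝ 𝔤),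
    ∀ x₀ : M, ∃ (e : Trivialization F (π F V)) (φ : F ≃ₗ[ℝ] 𝔤), x₀ ∈ e.baseSet ∧
      ContMDiffOn (I.prod 𝓘(ℝ, F)) (I.prod 𝓘(ℝ, F)) ∞ e e.source ∧
      ContMDiffOn (I.prod 𝓘(ℝ, F)) (I.prod 𝓘(ℝ, F)) ∞ e.toOpenPartialHomeomorph.symm e.target ∧
      ∀ y ∈ e.baseSet, ∃ Φ : V y ≃ₗ⁅ℝ⁆ 𝔤, ∀ v : V y, φ (e ⟨y, v⟩).2 = Φ v

end

/-! Near a point `x₀` transitivity allows the anchor to be split: there are sections `s v` of `A`,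
linear in `v`, whose anchors are the coordinate vector fields of a chart. In a local trivialization
`[s v, ·]` is the derivative along `v` plus a pointwise operator `Γ v` (`linearMapAt_bracket`), so
it is a connection on `A` near `x₀`. The anchor carries brackets to brackets and coordinate fields
commute, hence the anchor is parallel (`vecDeriv_chartAnchor`). The Jacobi identity says that `[s v,
·]` is a derivation, hence the bracket of `K` is parallel (`vecDeriv_bracketRep`). Parallel
transport therefore maps kernels to kernels by Lie algebra isomorphisms. Transport along the rays of
the chart compares `K` at `x₀` with `K` at every nearby point; its curvature plays no role
(`exists_kernel_lieEquiv`).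

Transport has to be smooth in the end point. The transport equation is written as an integral
equation in the Banach algebra of continuous curves on `[0, 1]`. Its coefficient depends smoothly on
the end point, because composition with a smooth map is smooth on spaces of continuous maps, and it
vanishes for the constant ray; inversion in a Banach algebra is smooth (`exists_radial_transport`).

By connectedness all fibres of `K` are isomorphic to one Lie algebra. Composing with the transports
gives smooth parametrizations of `K` with smooth left inverses; these make `K` a smooth subbundle
with fibrewise Lie trivializations (`exists_subbundleChart`). -/

set_option linter.unusedSectionVars false

noncomputable section

/-! ### Smoothness of composition operators on spaces of continuous maps -/

section Nemytskii

universe u v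

variable {K : Type*} [TopologicalSpace K] [CompactSpace K]

/-- Pointwise application of a continuous bilinear map to a pair of continuous maps. -/
def ContinuousMap.bilinL (K : Type*) [TopologicalSpace K] [CompactSpace K] {L E W : Type*}
    [NormedAddCommGroup L] [NormedSpace ℝ L] [NormedAddCommGroup E] [NormedSpace ℝ E]
    [NormedAddCommGroup W] [NormedSpace ℝ W] (B : L →L[ℝ] E →L[ℝ] W) :
    C(K, L) →L[ℝ] C(K, E) →L[ℝ] C(K, W) :=
  LinearMap.mkContinuous₂
    (LinearMap.mk₂ ℝ (fun (a : C(K, L)) (u : C(K, E)) => (⟨fun s => B (a s) (u s),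
          (B.continuous.comp a.continuous).clm_apply u.continuous⟩ : C(K, W)))
      (fun _ _ _ => by ext; simp) (fun _ _ _ => by ext; simp)
      (fun _ _ _ => by ext; simp) (fun _ _ _ => by ext; simp))
    ‖B‖ (fun a u => by
      refine (ContinuousMap.norm_le _ (by positivity)).2 fun s => ?_
      refine (B.le_opNorm₂ (a s) (u s)).trans ?_
      gcongr
      · exact a.norm_coe_le_norm s
      · exact u.norm_coe_le_norm s)

/-- Mean value inequality on the segment from `u s` to `u s + w s`. The bound is uniform in `s`
because `v ↦ f' ∘ v` is continuous for the sup norm. -/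
theorem ContinuousMap.hasFDerivAt_comp_left {L E W : Type*}
    [NormedAddCommGroup L] [NormedSpace ℝ L] [NormedAddCommGroup E] [NormedSpace ℝ E]
    [NormedAddCommGroup W] [NormedSpace ℝ W] (B : L →L[ℝ] E →L[ℝ] W) (f : C(E, W)) (f' : C(E, L))
    (hf : ∀ x, HasFDerivAt f (B (f' x)) x) (u : C(K, E)) :
    HasFDerivAt (fun u : C(K, E) => f.comp u) (ContinuousMap.bilinL K B (f'.comp u)) u := by
  rw [hasFDerivAt_iff_isLittleO_nhds_zero, Asymptotics.isLittleO_iff]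
  intro ε hε
  have hc : Continuous fun v : C(K, E) => f'.comp v := ContinuousMap.continuous_postcomp f'
  have hε' : 0 < ε / (‖B‖ + 1) := by positivity
  obtain ⟨δ, hδ, h⟩ := Metric.continuousAt_iff.1 (hc.continuousAt (x := u)) _ hε'
  filter_upwards [Metric.ball_mem_nhds (0 : C(K, E)) hδ] with w hw
  refine (ContinuousMap.norm_le _ (by positivity)).2 fun s => ?_
  have key : ‖f (u s + w s) - f (u s) - B (f' (u s)) (u s + w s - u s)‖
      ≤ ε * ‖u s + w s - u s‖ := by
    refine (convex_segment (u s) (u s + w s)).norm_image_sub_le_of_norm_hasFDerivWithin_le'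
      (f := f) (f' := fun x => B (f' x)) (fun x _ => (hf x).hasFDerivWithinAt) ?_
      (left_mem_segment ℝ _ _) (right_mem_segment ℝ _ _)
    intro x hx
    rw [segment_eq_image'] at hx
    obtain ⟨θ, hθ, rfl⟩ := hx
    have h1 : dist (u + θ • w) u < δ := by
      rw [dist_eq_norm, add_sub_cancel_left, norm_smul, Real.norm_eq_abs, abs_of_nonneg hθ.1]
      rw [mem_ball_zero_iff] at hw
      exact (mul_le_of_le_one_left (norm_nonneg _) hθ.2).trans_lt hw
    have h2 := (ContinuousMap.dist_lt_iff hε').1 (h h1) s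
    rw [dist_eq_norm] at h2
    have h3 : ‖f' (u s + θ • w s) - f' (u s)‖ ≤ ε / (‖B‖ + 1) := h2.le
    rw [add_sub_cancel_left, ← map_sub]
    refine (B.le_opNorm _).trans ((mul_le_mul_of_nonneg_left h3 (norm_nonneg _)).trans ?_)
    rw [mul_div_assoc', div_le_iff₀ (by positivity)]
    nlinarith [norm_nonneg B]
  rw [add_sub_cancel_left] at key
  refine key.trans (mul_le_mul_of_nonneg_left (w.norm_coe_le_norm s) hε.le)

/-- The derivative is composition with `f'` followed by a continuous linear map, so induction on `n`
applies to `f'`. As `f'` takes values in `E →L[ℝ] W`, the universe of `W` must contain that of `E`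
for the induction to close. -/
theorem ContinuousMap.contDiff_comp_left_aux {E : Type u} [NormedAddCommGroup E]
    [NormedSpace ℝ E] (n : ℕ) : ∀ {W : Type max u v} [NormedAddCommGroup W] [NormedSpace ℝ W]
      (f : C(E, W)), ContDiff ℝ n f → ContDiff ℝ n (fun u : C(K, E) => f.comp u) := by
  induction n with
  | zero =>
    intro W _ _ f _
    exact contDiff_zero.2 (ContinuousMap.continuous_postcomp f)
  | succ n ih =>
    intro W _ _ f hf
    obtain ⟨f', hf', hd⟩ := contDiff_succ_iff_hasFDerivAt.1 (by exact_mod_cast hf)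
    have h := (ContinuousMap.bilinL K (ContinuousLinearMap.id ℝ (E →L[ℝ] W))).contDiff.comp
      (ih ⟨f', hf'.continuous⟩ hf')
    have h2 := contDiff_succ_iff_hasFDerivAt.2 ⟨_, h, ContinuousMap.hasFDerivAt_comp_left
      (ContinuousLinearMap.id ℝ (E →L[ℝ] W)) f ⟨f', hf'.continuous⟩ hd⟩
    exact_mod_cast h2

/-- Composition with a smooth map is smooth on spaces of continuous maps with compact source. -/
theorem ContinuousMap.contDiff_comp_left {E : Type u} [NormedAddCommGroup E]
    [NormedSpace ℝ E] {W : Type v} [NormedAddCommGroup W] [NormedSpace ℝ W]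
    (f : C(E, W)) (hf : ContDiff ℝ ∞ f) : ContDiff ℝ ∞ (fun u : C(K, E) => f.comp u) := by
  rw [contDiff_infty]
  intro n
  -- Lifting `W` meets the universe constraint of the induction.
  let e : W ≃L[ℝ] ULift.{u} W := ContinuousLinearEquiv.ulift.symm
  have h := ContinuousMap.contDiff_comp_left_aux.{u, v} (K := K) n
    ((e : C(W, ULift.{u} W)).comp f) (e.contDiff.comp (hf.of_le (by exact_mod_cast le_top)))
  exact ((e.symm : ULift.{u} W →L[ℝ] W).compLeftContinuous ℝ K).contDiff.comp h

end Nemytskii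

/-! ### Primitives of continuous curves on the unit interval -/

section Volterra

open unitInterval

variable {W : Type*} [NormedAddCommGroup W] [NormedSpace ℝ W]

/-- The continuous extension to `ℝ` of the primitive that vanishes at `0`. -/
def unitPrimitive (f : C(I, W)) (t : ℝ) : W := ∫ s in (0 : ℝ)..t, f (Set.projIcc 0 1 zero_le_one s)

/-- The integrand is extended by constants beyond `[0, 1]`, so the derivative is two-sided at the
end points as well. -/
theorem hasDerivAt_unitPrimitive [CompleteSpace W] (f : C(I, W)) (t : ℝ) :
    HasDerivAt (unitPrimitive f) (f (Set.projIcc 0 1 zero_le_one t)) t := by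
  have hc : Continuous fun s : ℝ => f (Set.projIcc 0 1 zero_le_one s) :=
    f.continuous.comp continuous_projIcc
  exact hc.integral_hasStrictDerivAt 0 t |>.hasDerivAt

/-- The operator that takes a continuous map on `[0, 1]` to its primitive that vanishes at `0`. -/
def volterra (W : Type*) [NormedAddCommGroup W] [NormedSpace ℝ W] [CompleteSpace W] :
    C(I, W) →L[ℝ] C(I, W) :=
  LinearMap.mkContinuous
    { toFun := fun f => ⟨fun t => unitPrimitive f t, by
        have : Continuous (unitPrimitive f) :=
          continuous_iff_continuousAt.2 fun t => (hasDerivAt_unitPrimitive f t).continuousAt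
        exact this.comp continuous_subtype_val⟩
      map_add' := fun f g => by
        ext t
        have hc : ∀ f : C(I, W), Continuous fun s : ℝ => f (Set.projIcc 0 1 zero_le_one s) :=
          fun f => f.continuous.comp continuous_projIcc
        exact intervalIntegral.integral_add ((hc f).intervalIntegrable _ _)
          ((hc g).intervalIntegrable _ _)
      map_smul' := fun r f => by
        ext t
        exact intervalIntegral.integral_smul r _ }
    1 (fun f => by
      rw [one_mul]
      refine (ContinuousMap.norm_le _ (norm_nonneg _)).2 fun t => ?_
      refine (intervalIntegral.norm_integral_le_of_norm_le_const
        (fun s _ => f.norm_coe_le_norm _)).trans ?_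
      rw [sub_zero, abs_of_nonneg t.2.1]
      exact mul_le_of_le_one_right (norm_nonneg _) t.2.2)

end Volterra

/-! ### Parallel transport along rays in a vector space -/

section RadialTransport

open unitInterval Metric

variable {E : Type*} [NormedAddCommGroup E] [NormedSpace ℝ E]
  {R : Type*} [NormedRing R] [NormedAlgebra ℝ R]

/-- The equation `p + J (a p) = 1` in a Banach algebra has a solution that depends smoothly on a
small parameter `a`. -/
theorem exists_contDiffOn_add_apply_mul_eq_one {Y : Type*} [NormedRing Y] [NormedAlgebra ℝ Y]
    [CompleteSpace Y] (J : Y →L[ℝ] Y) {a : E → Y} (ha : ContDiff ℝ ∞ a) {z₀ : E} (ha0 : a z₀ = 0) :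
    ∃ (O : Set E) (P : E → Y), IsOpen O ∧ z₀ ∈ O ∧ ContDiffOn ℝ ∞ P O ∧
      ∀ z ∈ O, P z + J (a z * P z) = 1 := by
  -- `T z` is the operator `p ↦ p + J (a z * p)`. It is the identity at `z₀`, hence invertible
  -- nearby, and the solution is its inverse applied to `1`.
  let T : E → Y →L[ℝ] Y := fun z => 1 + J.comp (ContinuousLinearMap.mul ℝ Y (a z))
  have hm : ContDiff ℝ ∞ fun z => ContinuousLinearMap.mul ℝ Y (a z) :=
    (ContinuousLinearMap.mul ℝ Y).contDiff.comp ha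
  have hT : ContDiff ℝ ∞ T := contDiff_const.add ((contDiff_const (c := J)).clm_comp hm)
  have hT0 : T z₀ = 1 := by simp [T, ha0]
  refine ⟨T ⁻¹' {y | IsUnit y}, fun z => Ring.inverse (T z) 1,
    Units.isOpen.preimage hT.continuous, ?_, ?_, ?_⟩
  · show IsUnit (T z₀)
    rw [hT0]
    exact isUnit_one
  · rintro z ⟨y, hy⟩
    have h0 : ContDiffAt ℝ ∞ Ring.inverse (T z) := by
      rw [← hy]
      exact contDiffAt_ringInverse ℝ y
    have h1 : ContDiffAt ℝ ∞ (fun z => Ring.inverse (T z)) z := h0.comp z hT.contDiffAt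
    exact (h1.clm_apply contDiffAt_const).contDiffWithinAt
  · intro z hz
    show (T z * Ring.inverse (T z)) 1 = 1
    rw [Ring.mul_inverse_cancel _ hz]
    rfl

/-- Parallel transport along rays from `z₀` for a smooth connection form. -/
theorem exists_radial_transport [CompleteSpace R] (Γ : E → E →L[ℝ] R)
    (hΓ : ContDiff ℝ ∞ Γ) (z₀ : E) :
    ∃ δ > 0, ∃ Q : E → ℝ → R,
      ContDiffOn ℝ ∞ (fun z => Q z 1) (ball z₀ δ) ∧
      ∀ z ∈ ball z₀ δ, IsUnit (Q z 1) ∧ Q z 0 = 1 ∧ ∀ t ∈ Set.Icc (0 : ℝ) 1,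
        HasDerivAt (Q z) (-(Γ (z₀ + t • (z - z₀)) (z - z₀) * Q z t)) t := by
  let f : C(E × E, R) := ⟨fun p => Γ p.1 p.2, by have := hΓ.continuous; fun_prop⟩
  have hf : ContDiff ℝ ∞ f := (hΓ.comp contDiff_fst).clm_apply contDiff_snd
  let j : E →L[ℝ] C(I, E × E) :=
    LinearMap.mkContinuous
      { toFun := fun v => ⟨fun s => ((s : ℝ) • v, v), by fun_prop⟩
        map_add' := fun v w => by ext s <;> simp
        map_smul' := fun r v => by ext s; exacts [smul_comm _ _ _, rfl] }
      1 (fun v => by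
        rw [one_mul]
        refine (ContinuousMap.norm_le _ (norm_nonneg _)).2 fun s => ?_
        refine norm_prod_le_iff.2 ⟨?_, le_rfl⟩
        show ‖(s : ℝ) • v‖ ≤ ‖v‖
        rw [norm_smul, Real.norm_eq_abs, abs_of_nonneg s.2.1]
        exact mul_le_of_le_one_left (norm_nonneg _) s.2.2)
  -- `u z` is the ray from `z₀` to `z` paired with its constant velocity `z - z₀`. It is affine in
  -- `z`, so the coefficient `a z` of the transport equation is smooth in `z`.
  let u : E → C(I, E × E) := fun z => ContinuousMap.const I (z₀, 0) + j (z - z₀)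
  have hu : ContDiff ℝ ∞ u := contDiff_const.add (j.contDiff.comp (contDiff_id.sub contDiff_const))
  let a : E → C(I, R) := fun z => f.comp (u z)
  have ha : ContDiff ℝ ∞ a := (ContinuousMap.contDiff_comp_left f hf).comp hu
  have ha_apply : ∀ z (s : I), a z s = Γ (z₀ + (s : ℝ) • (z - z₀)) (z - z₀) := by
    intro z s
    show Γ (z₀ + (s : ℝ) • (z - z₀)) (0 + (z - z₀)) = _
    rw [zero_add]
  have ha0 : a z₀ = 0 := by ext s : 1; rw [ha_apply]; simp
  obtain ⟨O, P, hO, hz₀, hP, hPe⟩ := exists_contDiffOn_add_apply_mul_eq_one (volterra R) ha ha0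
  -- `P z` is defined on `[0, 1]` only. The integral equation identifies it there with `Q z`, which
  -- is defined on `ℝ` and has two-sided derivatives.
  let Q : E → ℝ → R := fun z t => 1 - unitPrimitive (a z * P z) t
  have hQ1 : ∀ z ∈ O, ∀ s : I, Q z s = P z s := by
    intro z hz s
    have h3 : P z s + unitPrimitive (a z * P z) s = 1 :=
      congrArg (fun g : C(I, R) => g s) (hPe z hz)
    show 1 - unitPrimitive (a z * P z) s = P z s
    rw [← h3]; abel
  have hΨ : ContDiffOn ℝ ∞ (fun z => Q z 1) O := by
    have h1 : ContDiffOn ℝ ∞ (fun z => P z 1) O :=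
      (ContinuousMap.evalCLM ℝ (1 : I) : C(I, R) →L[ℝ] R).contDiff.comp_contDiffOn hP
    exact h1.congr fun y hy => hQ1 y hy 1
  -- Invertibility comes from continuity at `z₀`, where the transport is `1`, at the cost of a
  -- smaller ball.
  have hQu : {z | IsUnit (Q z 1)} ∈ 𝓝 z₀ := by
    refine (hΨ.contDiffAt (hO.mem_nhds hz₀)).continuousAt.preimage_mem_nhds
      (Units.isOpen.mem_nhds ?_)
    have : Q z₀ 1 = 1 := by simp [Q, ha0, unitPrimitive]
    show IsUnit (Q z₀ 1)
    rw [this]; exact isUnit_one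
  obtain ⟨δ, hδ, hsub⟩ := Metric.mem_nhds_iff.1 (Filter.inter_mem (hO.mem_nhds hz₀) hQu)
  refine ⟨δ, hδ, Q, hΨ.mono fun z hz => (hsub hz).1, fun z hz => ⟨(hsub hz).2, ?_, ?_⟩⟩
  · simp [Q, unitPrimitive]
  · intro t ht
    have h := (hasDerivAt_unitPrimitive (a z * P z) t).const_sub 1
    have e : (a z * P z) (Set.projIcc 0 1 zero_le_one t)
        = Γ (z₀ + t • (z - z₀)) (z - z₀) * Q z t := by
      rw [Set.projIcc_of_mem zero_le_one ht]
      show a z ⟨t, ht⟩ * P z ⟨t, ht⟩ = _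
      rw [ha_apply, ← hQ1 z (hsub hz).1]
    rw [e] at h
    exact h

/-- A map that is smooth on a neighbourhood of a point agrees near it with a globally smooth map. -/
theorem exists_contDiff_eqOn_ball [FiniteDimensional ℝ E] {W : Type*} [NormedAddCommGroup W]
    [NormedSpace ℝ W] {f : E → W} {O : Set E} (hO : IsOpen O) {z₀ : E} (hz₀ : z₀ ∈ O)
    (hf : ContDiffOn ℝ ∞ f O) :
    ∃ g : E → W, ContDiff ℝ ∞ g ∧ ∃ δ > 0, ball z₀ δ ⊆ O ∧ ∀ z ∈ ball z₀ δ, g z = f z := by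
  obtain ⟨ε, hε, hball⟩ := Metric.isOpen_iff.1 hO z₀ hz₀
  -- The outer radius `ε / 2` keeps the closed support inside the ball of radius `ε`, where `f` is
  -- smooth.
  let b : ContDiffBump z₀ := ⟨ε / 3, ε / 2, by positivity, by linarith⟩
  refine ⟨fun z => b z • f z, contDiff_iff_contDiffAt.2 fun z => ?_, ε / 3, by positivity,
    (ball_subset_ball (by linarith)).trans hball, fun z hz => ?_⟩
  · by_cases hz : z ∈ ball z₀ ε
    · exact b.contDiff.contDiffAt.smul (hf.contDiffAt (hO.mem_nhds (hball hz)))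
    · have h0 : (fun z => b z • f z) =ᶠ[𝓝 z] fun _ => 0 := by
        have hz' : z ∉ tsupport b := by
          rw [b.tsupport_eq]
          intro h
          exact hz (closedBall_subset_ball (show ε / 2 < ε by linarith) h)
        filter_upwards [(isClosed_tsupport b).isOpen_compl.mem_nhds hz'] with y hy
        rw [image_eq_zero_of_notMem_tsupport hy, zero_smul]
      exact contDiffAt_const.congr_of_eventuallyEq h0
  · show b z • f z = f z
    rw [b.one_of_mem_closedBall (ball_subset_closedBall hz), one_smul]

theorem DifferentiableAt.hasDerivAt_comp {X : Type*} [NormedAddCommGroup X]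
    [NormedSpace ℝ X] {f : E → X} {γ : ℝ → E} {t : ℝ} {v : E} (hf : DifferentiableAt ℝ f (γ t))
    (hγ : HasDerivAt γ v t) : HasDerivAt (fun t => f (γ t)) (fderiv ℝ f (γ t) v) t :=
  hf.hasFDerivAt.comp_hasDerivAt t hγ

theorem HasDerivAt.clm_apply₂ {X Y Z : Type*} [NormedAddCommGroup X] [NormedSpace ℝ X]
    [NormedAddCommGroup Y] [NormedSpace ℝ Y] [NormedAddCommGroup Z] [NormedSpace ℝ Z]
    {B : ℝ → X →L[ℝ] Y →L[ℝ] Z} {B' : X →L[ℝ] Y →L[ℝ] Z} {t : ℝ} {x : ℝ → X} {x' : X}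
    {y : ℝ → Y} {y' : Y} (hB : HasDerivAt B B' t) (hx : HasDerivAt x x' t)
    (hy : HasDerivAt y y' t) :
    HasDerivAt (fun t => B t (x t) (y t)) (B' (x t) (y t) + B t x' (y t) + B t (x t) y') t :=
  (hB.clm_apply hx).clm_apply hy

/-- Radial parallel transport for a connection form `Γ` preserves a parallel family of linear maps
`ρ`, and it preserves a family of bilinear maps `c` that is parallel on the kernels of `ρ`. -/
theorem exists_radial_transport_preserving [FiniteDimensional ℝ E]
    {V : Type*} [NormedAddCommGroup V] [NormedSpace ℝ V] [CompleteSpace V]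
    {W : Type*} [NormedAddCommGroup W] [NormedSpace ℝ W]
    {O : Set E} (hO : IsOpen O) {z₀ : E} (hz₀ : z₀ ∈ O)
    {Γ : E → E →L[ℝ] V →L[ℝ] V} (hΓ : ContDiffOn ℝ ∞ Γ O)
    {ρ : E → V →L[ℝ] W} (hρ : ∀ z ∈ O, DifferentiableAt ℝ ρ z)
    (hρΓ : ∀ z ∈ O, ∀ v f, fderiv ℝ ρ z v f = ρ z (Γ z v f))
    {c : E → V →L[ℝ] V →L[ℝ] V} (hc : ∀ z ∈ O, DifferentiableAt ℝ c z)
    (hcΓ : ∀ z ∈ O, ∀ v k l, ρ z k = 0 → ρ z l = 0 →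
      fderiv ℝ c z v k l + Γ z v (c z k l) = c z (Γ z v k) l + c z k (Γ z v l)) :
    ∃ δ > 0, ball z₀ δ ⊆ O ∧ ∃ Ψ : E → V →L[ℝ] V, ContDiffOn ℝ ∞ Ψ (ball z₀ δ) ∧
      ∀ z ∈ ball z₀ δ, IsUnit (Ψ z) ∧ (∀ k, ρ z (Ψ z k) = ρ z₀ k) ∧
        ∀ k l, ρ z₀ k = 0 → ρ z₀ l = 0 → c z (Ψ z k) (Ψ z l) = Ψ z (c z₀ k l) := by
  -- `exists_radial_transport` needs a form on all of `E`; rays from `z₀` stay in the ball where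
  -- `Γ'` equals `Γ`.
  obtain ⟨Γ', hΓ', δ₁, hδ₁, hsub, heq⟩ := exists_contDiff_eqOn_ball hO hz₀ hΓ
  obtain ⟨δ₂, hδ₂, Q, hQ, hQz⟩ := exists_radial_transport Γ' hΓ' z₀
  refine ⟨min δ₁ δ₂, lt_min hδ₁ hδ₂, (ball_subset_ball (min_le_left _ _)).trans hsub,
    fun z => Q z 1, hQ.mono (ball_subset_ball (min_le_right _ _)), fun z hz => ?_⟩
  obtain ⟨hu, h0, hd⟩ := hQz z (ball_subset_ball (min_le_right _ _) hz)
  let γ : ℝ → E := fun t => z₀ + t • (z - z₀)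
  have hγd : ∀ t, HasDerivAt γ (z - z₀) t := fun t => by
    have h := ((hasDerivAt_id t).smul_const (z - z₀)).const_add z₀
    rw [one_smul] at h
    exact h
  have hγ : ∀ t ∈ Set.Icc (0 : ℝ) 1, γ t ∈ ball z₀ δ₁ := by
    intro t ht
    have hz' := ball_subset_ball (min_le_left _ _) hz
    rw [mem_ball, dist_eq_norm] at hz' ⊢
    rw [show γ t - z₀ = t • (z - z₀) from add_sub_cancel_left _ _, norm_smul, Real.norm_eq_abs,
      abs_of_nonneg ht.1]
    exact (mul_le_of_le_one_left (norm_nonneg _) ht.2).trans_lt hz'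
  have hγ0 : γ 0 = z₀ := by simp [γ]
  have hγ1 : γ 1 = z := by simp [γ]
  have hQk : ∀ k, ∀ t ∈ Set.Icc (0 : ℝ) 1,
      HasDerivAt (fun t => Q z t k) (-(Γ (γ t) (z - z₀) (Q z t k))) t := by
    intro k t ht
    have h := (hd t ht).clm_apply (hasDerivAt_const t k)
    rw [heq _ (hγ t ht)] at h
    simpa using h
  -- In the derivative of `ρ (Q k)` the term from `ρ` cancels the term from `Q`. In particular
  -- transport keeps vectors in the kernels, which `hcΓ` requires below.
  have hρk : ∀ k, ∀ t ∈ Set.Icc (0 : ℝ) 1, ρ (γ t) (Q z t k) = ρ z₀ k := by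
    intro k
    have hD : ∀ t ∈ Set.Icc (0 : ℝ) 1, HasDerivAt (fun t => ρ (γ t) (Q z t k)) 0 t := by
      intro t ht
      have hO' := hsub (hγ t ht)
      have h := ((hρ _ hO').hasFDerivAt.comp_hasDerivAt t (hγd t)).clm_apply (hQk k t ht)
      rw [hρΓ _ hO', map_neg, Function.comp_apply, add_neg_cancel] at h
      exact h
    intro t ht
    have h := constant_of_has_deriv_right_zero
      (fun s hs => (hD s hs).continuousAt.continuousWithinAt)
      (fun s hs => (hD s (Set.Ico_subset_Icc_self hs)).hasDerivWithinAt) t ht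
    rw [h, hγ0, h0]
    rfl
  refine ⟨hu, fun k => ?_, fun k l hk hl => ?_⟩
  · have := hρk k 1 (Set.right_mem_Icc.2 zero_le_one)
    rwa [hγ1] at this
  · have hcont : Continuous fun t => Γ' (γ t) (z - z₀) := by
      have h1 := hΓ'.continuous
      have h2 : Continuous γ := continuous_iff_continuousAt.2 fun t => (hγd t).continuousAt
      exact (h1.comp h2).clm_apply continuous_const
    obtain ⟨C, hC⟩ := (isCompact_Icc (a := (0 : ℝ)) (b := 1)).exists_bound_of_continuousOn
      hcont.continuousOn
    -- Both `c (Q k) (Q l)` and `Q (c z₀ k l)` solve the linear equation `y' = -Γ y` with the same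
    -- initial value; the bound `C` supplies the Lipschitz constant for uniqueness.
    have hD1 : ∀ t ∈ Set.Icc (0 : ℝ) 1, HasDerivAt (fun t => c (γ t) (Q z t k) (Q z t l))
        (-(Γ (γ t) (z - z₀) (c (γ t) (Q z t k) (Q z t l)))) t := by
      intro t ht
      have hO' := hsub (hγ t ht)
      have hc1 : HasDerivAt (fun t => c (γ t)) (fderiv ℝ c (γ t) (z - z₀)) t :=
        DifferentiableAt.hasDerivAt_comp (X := V →L[ℝ] V →L[ℝ] V) (hc _ hO') (hγd t)
      have h := hc1.clm_apply₂ (hQk k t ht) (hQk l t ht)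
      convert h using 1
      have h2 := hcΓ _ hO' (z - z₀) (Q z t k) (Q z t l) (by rw [hρk k t ht, hk])
        (by rw [hρk l t ht, hl])
      rw [← eq_sub_iff_add_eq] at h2
      simp only [h2, map_neg,
        neg_apply]
      abel
    have hD2 := hQk (c z₀ k l)
    have hL : ∀ t ∈ Set.Ico (0 : ℝ) 1, LipschitzOnWith C.toNNReal
        (fun y => -(Γ (γ t) (z - z₀) y)) Set.univ := by
      intro t ht
      have ht' := Set.Ico_subset_Icc_self ht
      refine (LipschitzWith.of_dist_le_mul fun x y => ?_).lipschitzOnWith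
      rw [dist_neg_neg, dist_eq_norm, ← map_sub, dist_eq_norm, ← heq _ (hγ t ht')]
      exact (ContinuousLinearMap.le_opNorm _ _).trans (mul_le_mul_of_nonneg_right
        ((hC t ht').trans (Real.le_coe_toNNReal C)) (norm_nonneg _))
    have := ODE_solution_unique_of_mem_Icc_right hL
      (fun s hs => (hD1 s hs).continuousAt.continuousWithinAt)
      (fun s hs => (hD1 s (Set.Ico_subset_Icc_self hs)).hasDerivWithinAt) (fun _ _ => Set.mem_univ _)
      (fun s hs => (hD2 s hs).continuousAt.continuousWithinAt)
      (fun s hs => (hD2 s (Set.Ico_subset_Icc_self hs)).hasDerivWithinAt) (fun _ _ => Set.mem_univ _)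
      (by simp [h0, hγ0]) (Set.right_mem_Icc.2 zero_le_one)
    simpa only [hγ1] using this

end RadialTransport

/-! ### Subbundles from smooth local parametrizations -/

section Subbundle

variable {E : Type*} [NormedAddCommGroup E] [NormedSpace ℝ E]
  {H : Type*} [TopologicalSpace H] (I : ModelWithCorners ℝ E H)
  {M : Type*} [TopologicalSpace M] [ChartedSpace H M]
  (F : Type*) [NormedAddCommGroup F] [NormedSpace ℝ F]
  {A : M → Type*} [∀ x, AddCommGroup (A x)] [∀ x, Module ℝ (A x)]
  [∀ x, TopologicalSpace (A x)] [TopologicalSpace (TotalSpace F A)]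
  [FiberBundle F A] [VectorBundle ℝ F A]
  (F' : Type*) [NormedAddCommGroup F'] [NormedSpace ℝ F']
  (K : ∀ x, Submodule ℝ (A x))

/-- A smooth local parametrization `U × F' → A` of the family `K` of subspaces of the fibres of `A`,
with a smooth left inverse, both read in a local trivialization of `A`. -/
structure SubbundleChart where
  /-- the local trivialization of the ambient bundle -/
  triv : Trivialization F (π F A)
  /-- the domain -/
  U : Set M
  /-- the parametrization -/
  α : M → F' →L[ℝ] F
  /-- the left inverse -/
  β : M → F →L[ℝ] F'
  memAtlas : MemTrivializationAtlas triv
  isOpen : IsOpen U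
  subset : U ⊆ triv.baseSet
  contMDiffOn_α : ContMDiffOn I 𝓘(ℝ, F' →L[ℝ] F) ∞ α U
  contMDiffOn_β : ContMDiffOn I 𝓘(ℝ, F →L[ℝ] F') ∞ β U
  mem : ∀ y ∈ U, ∀ w, triv.symm y (α y w) ∈ K y
  β_α : ∀ y ∈ U, ∀ w, β y (α y w) = w
  α_β : ∀ y ∈ U, ∀ v ∈ K y, α y (β y (triv ⟨y, v⟩).2) = (triv ⟨y, v⟩).2

variable {K}

/-- The inclusion of total spaces of a family of subspaces. -/
def subbundleIncl (k : TotalSpace F' (fun x => K x)) : TotalSpace F A := ⟨k.proj, (k.2 : A k.proj)⟩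

theorem injective_subbundleIncl :
    Function.Injective (subbundleIncl F F' : TotalSpace F' (fun x => K x) → TotalSpace F A) := by
  rintro ⟨x, v⟩ ⟨y, w⟩ h
  obtain rfl : x = y := congrArg TotalSpace.proj h
  have h2 : (v : A x) = w := eq_of_heq (TotalSpace.mk.inj h).2
  rw [Subtype.ext h2]

variable {I F F'}

namespace SubbundleChart

attribute [instance] memAtlas

variable (c : SubbundleChart I F F' K)

open scoped Classical in
/-- The vector of `K y` with coordinates `w`. -/
def vec (y : M) (w : F') : K y :=
  -- Membership in `K y` is known only over `U`; elsewhere `0` is a default.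
  if h : y ∈ c.U then ⟨c.triv.symm y (c.α y w), c.mem y h w⟩ else 0

theorem coe_vec {y : M} (hy : y ∈ c.U) (w : F') :
    (c.vec y w : A y) = c.triv.symm y (c.α y w) := by
  rw [vec, dif_pos hy]

theorem triv_vec {y : M} (hy : y ∈ c.U) (w : F') :
    c.triv ⟨y, (c.vec y w : A y)⟩ = (y, c.α y w) := by
  rw [c.coe_vec hy, c.triv.apply_mk_symm (c.subset hy)]

theorem vec_coord {y : M} (hy : y ∈ c.U) (v : K y) :
    c.vec y (c.β y (c.triv ⟨y, (v : A y)⟩).2) = v := by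
  apply Subtype.ext
  rw [c.coe_vec hy, c.α_β y hy v v.2, c.triv.symm_apply_apply_mk (c.subset hy)]

variable [TopologicalSpace (TotalSpace F' (fun x => K x))]

theorem continuousOn_coord
    (hK : Topology.IsInducing (subbundleIncl F F' : TotalSpace F' (fun x => K x) → TotalSpace F A)) :
    ContinuousOn (fun k : TotalSpace F' (fun x => K x) =>
      (k.proj, c.β k.proj (c.triv ⟨k.proj, (k.2 : A k.proj)⟩).2)) (π F' (fun x => K x) ⁻¹' c.U) := by
  have hi : Continuous (subbundleIncl F F' : TotalSpace F' (fun x => K x) → TotalSpace F A) :=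
    hK.continuous
  have hp : Continuous fun k : TotalSpace F' (fun x => K x) => k.proj :=
    (FiberBundle.continuous_proj F A).comp hi
  have h1 : ContinuousOn (fun k : TotalSpace F' (fun x => K x) =>
      (c.triv ⟨k.proj, (k.2 : A k.proj)⟩).2) (π F' (fun x => K x) ⁻¹' c.U) := by
    refine continuous_snd.comp_continuousOn (c.triv.continuousOn.comp hi.continuousOn fun k hk => ?_)
    exact c.triv.mem_source.2 (c.subset hk)
  refine hp.continuousOn.prodMk (ContinuousOn.clm_apply ?_ h1)
  exact c.contMDiffOn_β.continuousOn.comp hp.continuousOn fun k hk => hk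

theorem continuousOn_mk_vec
    (hK : Topology.IsInducing (subbundleIncl F F' : TotalSpace F' (fun x => K x) → TotalSpace F A)) :
    ContinuousOn (fun p : M × F' => (⟨p.1, c.vec p.1 p.2⟩ : TotalSpace F' (fun x => K x)))
      (c.U ×ˢ Set.univ) := by
  rw [hK.continuousOn_iff]
  have h1 : ContinuousOn (fun p : M × F' => (p.1, c.α p.1 p.2)) (c.U ×ˢ Set.univ) := by
    refine continuous_fst.continuousOn.prodMk (ContinuousOn.clm_apply ?_ continuous_snd.continuousOn)
    exact c.contMDiffOn_α.continuousOn.comp continuous_fst.continuousOn fun p hp => hp.1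
  refine (c.triv.continuousOn_symm.comp h1 fun p hp => ⟨c.subset hp.1, trivial⟩).congr fun p hp => ?_
  show (⟨p.1, (c.vec p.1 p.2 : A p.1)⟩ : TotalSpace F A) = _
  rw [c.coe_vec hp.1]
  rfl

variable (hK : Topology.IsInducing (subbundleIncl F F' : TotalSpace F' (fun x => K x) → TotalSpace F A))

/-- The local trivialization of `K` defined by a chart. -/
def trivialization : Trivialization F' (π F' (fun x => K x)) where
  toFun k := (k.proj, c.β k.proj (c.triv ⟨k.proj, (k.2 : A k.proj)⟩).2)
  invFun p := ⟨p.1, c.vec p.1 p.2⟩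
  source := π F' (fun x => K x) ⁻¹' c.U
  target := c.U ×ˢ Set.univ
  map_source' k hk := ⟨hk, trivial⟩
  map_target' p hp := hp.1
  left_inv' k hk := by
    show (⟨k.proj, c.vec k.proj (c.β k.proj (c.triv ⟨k.proj, (k.2 : A k.proj)⟩).2)⟩ :
      TotalSpace F' (fun x => K x)) = k
    rw [c.vec_coord hk]
  right_inv' p hp := by
    show (p.1, c.β p.1 (c.triv ⟨p.1, (c.vec p.1 p.2 : A p.1)⟩).2) = p
    rw [c.triv_vec hp.1, c.β_α _ hp.1]
  open_source := c.isOpen.preimage ((FiberBundle.continuous_proj F A).comp hK.continuous)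
  open_target := c.isOpen.prod isOpen_univ
  continuousOn_toFun := c.continuousOn_coord hK
  continuousOn_invFun := c.continuousOn_mk_vec hK
  baseSet := c.U
  open_baseSet := c.isOpen
  source_eq := rfl
  target_eq := rfl
  proj_toFun _ _ := rfl

theorem trivialization_apply (k : TotalSpace F' (fun x => K x)) :
    c.trivialization hK k = (k.proj, c.β k.proj (c.triv ⟨k.proj, (k.2 : A k.proj)⟩).2) := rfl

theorem trivialization_vec {y : M} (hy : y ∈ c.U) (w : F') :
    c.trivialization hK ⟨y, c.vec y w⟩ = (y, w) := by
  rw [trivialization_apply, c.triv_vec hy, c.β_α _ hy]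

instance : (c.trivialization hK).IsLinear ℝ where
  linear y hy := by
    have hl := c.triv.linear ℝ (c.subset hy)
    refine ⟨fun v w => ?_, fun r v => ?_⟩
    · simp only [trivialization_apply, Submodule.coe_add, hl.map_add, map_add]
    · simp only [trivialization_apply, Submodule.coe_smul, hl.map_smul, map_smul]

/-- The transition map factors as `α` of the first chart, a coordinate change of `A`, and `β` of the
second chart, all smooth in the base point. -/
theorem contMDiffOn_coordChangeL [ContMDiffVectorBundle ∞ F A I] (c c' : SubbundleChart I F F' K) :
    ContMDiffOn I 𝓘(ℝ, F' →L[ℝ] F') ∞ (fun y =>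
      ((c.trivialization hK).coordChangeL ℝ (c'.trivialization hK) y : F' →L[ℝ] F'))
      (c.U ∩ c'.U) := by
  have h1 := (_root_.contMDiffOn_coordChangeL (n := ∞) (IB := I) c.triv c'.triv).mono
    (Set.inter_subset_inter c.subset c'.subset)
  have h2 := (c'.contMDiffOn_β.mono (Set.inter_subset_right (s := c.U))).clm_comp
    (h1.clm_comp (c.contMDiffOn_α.mono (Set.inter_subset_left (t := c'.U))))
  refine h2.congr fun y hy => ?_
  ext1 w
  have hs : (c.trivialization hK).symm y w = c.vec y w := by
    have h := (c.trivialization hK).symm_apply_apply_mk (b := y) hy.1 (c.vec y w)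
    rwa [c.trivialization_vec hK hy.1] at h
  show (c.trivialization hK).coordChangeL ℝ (c'.trivialization hK) y w
    = c'.β y (c.triv.coordChangeL ℝ c'.triv y (c.α y w))
  rw [(c.trivialization hK).coordChangeL_apply (c'.trivialization hK) hy,
    c.triv.coordChangeL_apply c'.triv ⟨c.subset hy.1, c'.subset hy.2⟩, hs, trivialization_apply,
    c.coe_vec hy.1]

/-- The fibre bundle structure on `K` defined by a family of charts around all points. -/
@[reducible]
def fiberBundle (c : M → SubbundleChart I F F' K) (hc : ∀ x, x ∈ (c x).U) :
    FiberBundle F' (fun x => K x) where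
  totalSpaceMk_isInducing' x := by
    rw [← hK.of_comp_iff]
    exact (FiberBundle.totalSpaceMk_isInducing F A x).comp Topology.IsInducing.subtypeVal
  trivializationAtlas' := Set.range fun x => (c x).trivialization hK
  trivializationAt' x := (c x).trivialization hK
  mem_baseSet_trivializationAt' := hc
  trivialization_mem_atlas' x := ⟨x, rfl⟩

theorem vectorBundle [ContMDiffVectorBundle ∞ F A I] (c : M → SubbundleChart I F F' K)
    (hc : ∀ x, x ∈ (c x).U) :
    letI := fiberBundle hK c hc
    VectorBundle ℝ F' (fun x => K x) := by
  let := fiberBundle hK c hc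
  refine { trivialization_linear' := ?_, continuousOn_coordChange' := ?_ }
  · rintro _ ⟨x, rfl⟩
    infer_instance
  · rintro _ _ ⟨x, rfl⟩ ⟨x', rfl⟩
    exact (contMDiffOn_coordChangeL hK (c x) (c x')).continuousOn

theorem contMDiffVectorBundle [ContMDiffVectorBundle ∞ F A I] (c : M → SubbundleChart I F F' K)
    (hc : ∀ x, x ∈ (c x).U) :
    letI := fiberBundle hK c hc
    letI := vectorBundle hK c hc
    ContMDiffVectorBundle ∞ F' (fun x => K x) I := by
  let := fiberBundle hK c hc
  let := vectorBundle hK c hc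
  constructor
  rintro _ _ ⟨x, rfl⟩ ⟨x', rfl⟩
  exact contMDiffOn_coordChangeL hK (c x) (c x')

/-- In the trivializations of a chart the inclusion is `(y, w) ↦ (y, α y w)`. -/
theorem contMDiff_subbundleIncl [IsManifold I ∞ M] [ContMDiffVectorBundle ∞ F A I]
    (c : M → SubbundleChart I F F' K) (hc : ∀ x, x ∈ (c x).U) :
    letI := fiberBundle hK c hc
    ContMDiff (I.prod 𝓘(ℝ, F')) (I.prod 𝓘(ℝ, F)) ∞
      (subbundleIncl F F' : TotalSpace F' (fun x => K x) → TotalSpace F A) := by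
  let := fiberBundle hK c hc
  let := vectorBundle hK c hc
  have := contMDiffVectorBundle hK c hc
  intro k
  let c' := c k.proj
  let e := c'.trivialization hK
  have : MemTrivializationAtlas e := ⟨⟨k.proj, rfl⟩⟩
  have h1 : ContMDiffOn (I.prod 𝓘(ℝ, F')) (I.prod 𝓘(ℝ, F')) ∞ e e.source := e.contMDiffOn
  have hp : ContMDiffOn (I.prod 𝓘(ℝ, F')) I ∞ (fun k : TotalSpace F' (fun x => K x) => k.proj)
    e.source := contMDiffOn_proj _
  have h2 : ContMDiffOn (I.prod 𝓘(ℝ, F')) (I.prod 𝓘(ℝ, F)) ∞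
      (fun k : TotalSpace F' (fun x => K x) => (k.proj, c'.α k.proj (e k).2)) e.source :=
    hp.prodMk ((c'.contMDiffOn_α.comp hp fun y hy => hy).clm_apply
      (contMDiff_snd.comp_contMDiffOn h1))
  have h3 : ContMDiffOn (I.prod 𝓘(ℝ, F')) (I.prod 𝓘(ℝ, F)) ∞
      (subbundleIncl F F' : TotalSpace F' (fun x => K x) → TotalSpace F A) e.source := by
    refine (c'.triv.contMDiffOn_symm.comp h2 fun y hy => ?_).congr fun y hy => ?_
    · exact c'.triv.mem_target.2 (c'.subset hy)
    · show _ = c'.triv.toOpenPartialHomeomorph.symm (y.proj, c'.α y.proj (e y).2)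
      have h4 := c'.α_β y.proj hy (y.2 : A y.proj) y.2.2
      have h5 : (e y).2 = c'.β y.proj (c'.triv ⟨y.proj, (y.2 : A y.proj)⟩).2 := rfl
      rw [h5, h4, ← c'.triv.mk_symm (c'.subset hy), c'.triv.symm_apply_apply_mk (c'.subset hy)]
      rfl
  exact h3.contMDiffAt (e.open_source.mem_nhds (e.mem_source.2 (hc k.proj)))

end SubbundleChart

end Subbundle

/-! ### Local frames and the local form of the bracket -/

section Frames

variable {E : Type*} [NormedAddCommGroup E] [NormedSpace ℝ E]
  {H : Type*} [TopologicalSpace H] {I : ModelWithCorners ℝ E H}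
  {M : Type*} [TopologicalSpace M] [ChartedSpace H M]
  {F : Type*} [NormedAddCommGroup F] [NormedSpace ℝ F]
  {A : M → Type*} [∀ x, AddCommGroup (A x)] [∀ x, Module ℝ (A x)]
  [∀ x, TopologicalSpace (A x)] [TopologicalSpace (TotalSpace F A)]
  [FiberBundle F A] [VectorBundle ℝ F A]

/-- The derivative of a vector-valued function along a tangent vector. -/
def vecDeriv (I : ModelWithCorners ℝ E H) {W : Type*} [NormedAddCommGroup W] [NormedSpace ℝ W]
    (g : M → W) {x : M} (v : TangentSpace I x) : W :=
  mfderiv I 𝓘(ℝ, W) g x v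

/-- Evaluation of smooth sections at a point. -/
def sectionEval (x : M) : Cₛ^∞⟮I; F, A⟯ →ₗ[ℝ] A x where
  toFun s := s x
  map_add' _ _ := rfl
  map_smul' _ _ := rfl

theorem sectionEval_apply (x : M) (s : Cₛ^∞⟮I; F, A⟯) : sectionEval x s = s x := rfl

variable [FiniteDimensional ℝ E] [T2Space M] [IsManifold I ∞ M] [ContMDiffVectorBundle ∞ F A I]
  (t : Trivialization F (π F A)) [MemTrivializationAtlas t]

theorem contMDiffOn_linearMapAt_section (b : Cₛ^∞⟮I; F, A⟯) :
    ContMDiffOn I 𝓘(ℝ, F) ∞ (fun y => t.linearMapAt ℝ y (b y)) t.baseSet := by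
  refine ((t.contMDiffOn_section_baseSet_iff (IB := I) (n := ∞)).1
    b.contMDiff.contMDiffOn).congr fun y hy => ?_
  rw [t.coe_linearMapAt_of_mem hy]

theorem contMDiffOn_symm_section {U : Set M} (hU : IsOpen U) (hUt : U ⊆ t.baseSet) {g : M → F}
    (hg : ContMDiffOn I 𝓘(ℝ, F) ∞ g U) : ContMDiffOn I (I.prod 𝓘(ℝ, F)) ∞
      (fun y => TotalSpace.mk' F y (t.symmₗ ℝ y (g y))) U := by
  rw [t.contMDiffOn_section_iff hU hUt]
  refine hg.congr fun y hy => ?_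
  rw [t.symmₗ_apply (hUt hy), t.apply_mk_symm (hUt hy)]

/-- The global sections given near `x₀` by a smooth family of linear maps into the model fibre of a
local trivialization. -/
def frameSection {X : Type*} [NormedAddCommGroup X] [NormedSpace ℝ X] {U : Set M} (hU : IsOpen U)
    (hUt : U ⊆ t.baseSet) {x₀ : M} (ψ : SmoothBumpFunction I x₀) (hψ : tsupport ψ ⊆ U)
    {σ : M → X →L[ℝ] F} (hσ : ContMDiffOn I 𝓘(ℝ, X →L[ℝ] F) ∞ σ U) :
    X →ₗ[ℝ] Cₛ^∞⟮I; F, A⟯ where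
  toFun v := ⟨fun y => ψ y • t.symmₗ ℝ y (σ y v),
    ContMDiffOn.smul_section_of_tsupport ψ.contMDiff.contMDiffOn hU hψ
      (contMDiffOn_symm_section t hU hUt (hσ.clm_apply contMDiffOn_const))⟩
  map_add' v w := by
    ext y
    show ψ y • t.symmₗ ℝ y (σ y (v + w))
      = ψ y • t.symmₗ ℝ y (σ y v) + ψ y • t.symmₗ ℝ y (σ y w)
    rw [map_add, map_add, smul_add]
  map_smul' r v := by
    ext y
    show ψ y • t.symmₗ ℝ y (σ y (r • v)) = r • ψ y • t.symmₗ ℝ y (σ y v)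
    rw [map_smul, map_smul, smul_comm]

theorem frameSection_apply {X : Type*} [NormedAddCommGroup X] [NormedSpace ℝ X] {U : Set M}
    (hU : IsOpen U) (hUt : U ⊆ t.baseSet) {x₀ : M} (ψ : SmoothBumpFunction I x₀)
    (hψ : tsupport ψ ⊆ U) {σ : M → X →L[ℝ] F} (hσ : ContMDiffOn I 𝓘(ℝ, X →L[ℝ] F) ∞ σ U)
    (v : X) (y : M) :
    frameSection (A := A) t hU hUt ψ hψ hσ v y = ψ y • t.symmₗ ℝ y (σ y v) := rfl

variable {t} in
theorem mdifferentiableAt_linearMapAt_section (b : Cₛ^∞⟮I; F, A⟯) {x : M} (hx : x ∈ t.baseSet) :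
    MDifferentiableAt I 𝓘(ℝ, F) (fun y => t.linearMapAt ℝ y (b y)) x :=
  ((contMDiffOn_linearMapAt_section t b).contMDiffAt (t.open_baseSet.mem_nhds hx)).mdifferentiableAt
    (by simp)

/-- In a local trivialization, `[s, b] = D_{ρ(s)} b + Γ_s b` where `Γ_s` is pointwise. -/
theorem LieAlgebroid.linearMapAt_bracket [FiniteDimensional ℝ F] (L : LieAlgebroid I F A)
    {x₀ : M} (ψ : SmoothBumpFunction I x₀) (hψ : tsupport ψ ⊆ t.baseSet)
    (ε : F →ₗ[ℝ] Cₛ^∞⟮I; F, A⟯) (hε : ∀ f y, ε f y = ψ y • t.symmₗ ℝ y f)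
    (s b : Cₛ^∞⟮I; F, A⟯) {x : M} (hx : ∀ᶠ y in 𝓝 x, ψ y = 1) :
    t.linearMapAt ℝ x (L.bracket s b x)
      = vecDeriv I (fun y => t.linearMapAt ℝ y (b y)) (L.anchor x (s x))
        + t.linearMapAt ℝ x (L.bracket s (ε (t.linearMapAt ℝ x (b x))) x) := by
  have hx1 : ψ x = 1 := hx.self_of_nhds
  have hxt : x ∈ t.baseSet := hψ (subset_tsupport _ (by simp [hx1]))
  let B := Module.finBasis ℝ F
  let β : Fin (Module.finrank ℝ F) → F →L[ℝ] ℝ := fun i => (B.coord i).toContinuousLinearMap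
  have hB : ∀ f : F, ∑ i, β i f • B i = f := fun f => B.sum_repr f
  let ψ' : C^∞⟮I, M; ℝ⟯ := ⟨ψ, ψ.contMDiff⟩
  let c : Fin (Module.finrank ℝ F) → C^∞⟮I, M; ℝ⟯ := fun i =>
    ⟨fun y => ψ y • β i (t.linearMapAt ℝ y (b y)), by
      refine contMDiff_of_tsupport fun y hy => ?_
      have hy' : y ∈ t.baseSet := hψ (tsupport_smul_subset_left _ _ hy)
      exact ψ.contMDiffAt.smul ((β i).contMDiff.contMDiffAt.comp y
        ((contMDiffOn_linearMapAt_section t b).contMDiffAt (t.open_baseSet.mem_nhds hy')))⟩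
  -- Two factors of the cutoff are needed: one makes the coefficient global, the other the frame
  -- section.
  have hsum : funSmul I ψ' (funSmul I ψ' b) = ∑ i, funSmul I (c i) (ε (B i)) := by
    ext y
    rw [← sectionEval_apply y (∑ i, _), map_sum]
    show ψ y • ψ y • b y = ∑ i, (ψ y • β i (t.linearMapAt ℝ y (b y))) • ε (B i) y
    by_cases hy : y ∈ t.baseSet
    · have h1 : b y = ∑ i, β i (t.linearMapAt ℝ y (b y)) • t.symmₗ ℝ y (B i) := by
        simp only [← map_smul, ← map_sum]
        rw [hB, t.symmₗ_linearMapAt hy]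
      conv_lhs => rw [h1]
      rw [Finset.smul_sum, Finset.smul_sum]
      refine Finset.sum_congr rfl fun i _ => ?_
      rw [hε]
      simp only [smul_smul, smul_eq_mul]
      congr 1
      ring
    · have h0 : ψ y = 0 := image_eq_zero_of_notMem_tsupport fun h => hy (hψ h)
      simp [h0]
  -- Since `ψ` is `1` on a whole neighbourhood of `x`, the Leibniz rule yields no derivative of the
  -- cutoff.
  have hd0 : dirDeriv I ψ (L.anchor x (s x)) = 0 := by
    have h : mfderiv I 𝓘(ℝ, ℝ) ψ x = mfderiv I 𝓘(ℝ, ℝ) (fun _ => (1 : ℝ)) x :=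
      Filter.EventuallyEq.mfderiv_eq hx
    rw [dirDeriv, h, mfderiv_const]
    rfl
  have h1 : L.bracket s (funSmul I ψ' (funSmul I ψ' b)) x = L.bracket s b x := by
    have h0 : dirDeriv I ψ' (L.anchor x (s x)) = 0 := hd0
    have h2 : ψ' x = 1 := hx1
    rw [L.leibniz, L.leibniz, h0, zero_smul, zero_smul, add_zero, add_zero, h2, one_smul, one_smul]
  have hdc : ∀ i, dirDeriv I (c i) (L.anchor x (s x)) = β i (vecDeriv I
      (fun y => t.linearMapAt ℝ y (b y)) (L.anchor x (s x))) := by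
    intro i
    have he : (c i : M → ℝ) =ᶠ[𝓝 x] β i ∘ fun y => t.linearMapAt ℝ y (b y) := by
      filter_upwards [hx] with y hy
      show ψ y • β i (t.linearMapAt ℝ y (b y)) = β i (t.linearMapAt ℝ y (b y))
      rw [hy, one_smul]
    have hc2 := mfderiv_comp x (I := I) (β i).mdifferentiableAt
      (mdifferentiableAt_linearMapAt_section (t := t) b hxt)
    rw [ContinuousLinearMap.mfderiv_eq] at hc2
    rw [dirDeriv, he.mfderiv_eq, hc2]
    rfl
  have hcx : ∀ i, c i x = β i (t.linearMapAt ℝ x (b x)) := by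
    intro i
    show ψ x • β i (t.linearMapAt ℝ x (b x)) = β i (t.linearMapAt ℝ x (b x))
    rw [hx1, one_smul]
  have hεx : ∀ f, t.linearMapAt ℝ x (ε f x) = f := by
    intro f
    rw [hε, hx1, one_smul, t.linearMapAt_symmₗ hxt]
  rw [← h1, hsum, map_sum, ← sectionEval_apply x (∑ i, _), map_sum, map_sum]
  have h3 : ∀ i, t.linearMapAt ℝ x (sectionEval x (L.bracket s (funSmul I (c i) (ε (B i)))))
      = β i (t.linearMapAt ℝ x (b x)) • t.linearMapAt ℝ x (L.bracket s (ε (B i)) x)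
        + β i (vecDeriv I (fun y => t.linearMapAt ℝ y (b y)) (L.anchor x (s x))) • B i := by
    intro i
    rw [sectionEval_apply, L.leibniz, map_add, map_smul, map_smul, hdc, hcx, hεx]
  rw [Finset.sum_congr rfl fun i _ => h3 i, Finset.sum_add_distrib, add_comm]
  congr 1
  · exact hB _
  · conv_rhs => rw [← hB (t.linearMapAt ℝ x (b x))]
    simp only [map_sum, map_smul, ← sectionEval_apply]

end Frames

/-! ### Chart components of tangent vectors and of the anchor -/

section ChartAnchor

variable {E : Type*} [NormedAddCommGroup E] [NormedSpace ℝ E]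
  {H : Type*} [TopologicalSpace H] {I : ModelWithCorners ℝ E H}
  {M : Type*} [TopologicalSpace M] [ChartedSpace H M]
  {F : Type*} [NormedAddCommGroup F] [NormedSpace ℝ F]
  {A : M → Type*} [∀ x, AddCommGroup (A x)] [∀ x, Module ℝ (A x)]
  [∀ x, TopologicalSpace (A x)] [TopologicalSpace (TotalSpace F A)]
  [FiberBundle F A] [VectorBundle ℝ F A]

/-- A linear map on a finite-dimensional space is a continuous linear function of its values on a
basis. -/
theorem contMDiffOn_clm_of_apply [FiniteDimensional ℝ F] {W : Type*} [NormedAddCommGroup W]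
    [NormedSpace ℝ W] {g : M → F →L[ℝ] W} {U : Set M}
    (hg : ∀ f, ContMDiffOn I 𝓘(ℝ, W) ∞ (fun x => g x f) U) :
    ContMDiffOn I 𝓘(ℝ, F →L[ℝ] W) ∞ g U := by
  let B := Module.finBasis ℝ F
  let e : (Fin (Module.finrank ℝ F) → W) →L[ℝ] F →L[ℝ] W :=
    ∑ i, (ContinuousLinearMap.smulRightL ℝ F W (B.coord i).toContinuousLinearMap).comp
      (ContinuousLinearMap.proj (R := ℝ) (φ := fun _ : Fin (Module.finrank ℝ F) => W) i)
  have h : ContMDiffOn I 𝓘(ℝ, Fin (Module.finrank ℝ F) → W) ∞ (fun x i => g x (B i)) U :=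
    contMDiffOn_pi_space.2 fun i => hg (B i)
  refine (e.contMDiff.comp_contMDiffOn h).congr fun x _ => ?_
  ext1 f
  conv_lhs => rw [← B.sum_repr f, map_sum]
  simp [e]

variable [IsManifold I ∞ M]

variable (I) in
/-- The components of a tangent vector in the chart around `x₀`. -/
def chartVec (x₀ x : M) : TangentSpace I x →L[ℝ] E :=
  (trivializationAt E (TangentSpace I) x₀).continuousLinearMapAt ℝ x

theorem chartVec_injective {x₀ x : M} (hx : x ∈ (chartAt H x₀).source) :
    Function.Injective (chartVec I x₀ x) := by
  have hx' : x ∈ (trivializationAt E (TangentSpace I) x₀).baseSet := hx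
  refine Function.LeftInverse.injective (g := (trivializationAt E (TangentSpace I) x₀).symmL ℝ x)
    fun v => ?_
  exact (trivializationAt E (TangentSpace I) x₀).symmL_continuousLinearMapAt hx' v

theorem chartVec_surjective {x₀ x : M} (hx : x ∈ (chartAt H x₀).source) :
    Function.Surjective (chartVec I x₀ x) := by
  have hx' : x ∈ (trivializationAt E (TangentSpace I) x₀).baseSet := hx
  exact fun v => ⟨(trivializationAt E (TangentSpace I) x₀).symmL ℝ x v,
    (trivializationAt E (TangentSpace I) x₀).continuousLinearMapAt_symmL hx' v⟩

theorem vecDeriv_extChartAt {x₀ x : M} (hx : x ∈ (chartAt H x₀).source) (u : TangentSpace I x) :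
    vecDeriv I (extChartAt I x₀) u = chartVec I x₀ x u := by
  rw [chartVec, TangentBundle.continuousLinearMapAt_trivializationAt hx]
  rfl

theorem vecDeriv_comp {W W' : Type*} [NormedAddCommGroup W] [NormedSpace ℝ W]
    [NormedAddCommGroup W'] [NormedSpace ℝ W'] {g : M → W} {k : W → W'} {x : M}
    (hk : DifferentiableAt ℝ k (g x)) (hg : MDifferentiableAt I 𝓘(ℝ, W) g x)
    (u : TangentSpace I x) :
    vecDeriv I (k ∘ g) u = fderiv ℝ k (g x) (vecDeriv I g u) := by
  have h := mfderiv_comp x (I := I) hk.mdifferentiableAt hg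
  rw [mfderiv_eq_fderiv] at h
  rw [vecDeriv, h]
  rfl

theorem vecDeriv_clm_comp {W W' : Type*} [NormedAddCommGroup W] [NormedSpace ℝ W]
    [NormedAddCommGroup W'] [NormedSpace ℝ W'] {g : M → W} (k : W →L[ℝ] W') {x : M}
    (hg : MDifferentiableAt I 𝓘(ℝ, W) g x) (u : TangentSpace I x) :
    vecDeriv I (fun y => k (g y)) u = k (vecDeriv I g u) := by
  have h := vecDeriv_comp k.differentiableAt hg u
  rwa [k.fderiv] at h

theorem vecDeriv_congr {W : Type*} [NormedAddCommGroup W] [NormedSpace ℝ W] {g g' : M → W} {x : M}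
    (h : g =ᶠ[𝓝 x] g') (u : TangentSpace I x) : vecDeriv I g u = vecDeriv I g' u := by
  rw [vecDeriv, h.mfderiv_eq]
  rfl

theorem vecDeriv_const {W : Type*} [NormedAddCommGroup W] [NormedSpace ℝ W] (w : W) {x : M}
    (u : TangentSpace I x) : vecDeriv I (fun _ => w) u = 0 := by
  rw [vecDeriv, mfderiv_const]
  rfl

theorem mdifferentiableAt_comp_extChartAt_symm [I.Boundaryless] {W : Type*} [NormedAddCommGroup W]
    [NormedSpace ℝ W] {g : M → W} {x₀ x : M} (hx : x ∈ (chartAt H x₀).source)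
    (hg : MDifferentiableAt I 𝓘(ℝ, W) g x) :
    DifferentiableAt ℝ (g ∘ (extChartAt I x₀).symm) (extChartAt I x₀ x) := by
  have hxs : x ∈ (extChartAt I x₀).source := by rwa [extChartAt_source]
  have h1 : MDifferentiableAt 𝓘(ℝ, E) I (extChartAt I x₀).symm (extChartAt I x₀ x) :=
    ((contMDiffOn_extChartAt_symm (I := I) (n := ∞) x₀).contMDiffAt
      ((isOpen_extChartAt_target x₀).mem_nhds ((extChartAt I x₀).map_source hxs))).mdifferentiableAt
      (by simp)
  have hg' : MDifferentiableAt I 𝓘(ℝ, W) g ((extChartAt I x₀).symm (extChartAt I x₀ x)) := by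
    rwa [(extChartAt I x₀).left_inv hxs]
  exact (hg'.comp _ h1).differentiableAt

theorem fderiv_comp_extChartAt_symm [I.Boundaryless] {W : Type*} [NormedAddCommGroup W]
    [NormedSpace ℝ W] {g : M → W} {x₀ x : M} (hx : x ∈ (chartAt H x₀).source)
    (hg : MDifferentiableAt I 𝓘(ℝ, W) g x) (u : TangentSpace I x) :
    fderiv ℝ (g ∘ (extChartAt I x₀).symm) (extChartAt I x₀ x) (chartVec I x₀ x u)
      = vecDeriv I g u := by
  have hxs : x ∈ (extChartAt I x₀).source := by rwa [extChartAt_source]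
  rw [← vecDeriv_extChartAt hx, ← vecDeriv_comp (mdifferentiableAt_comp_extChartAt_symm hx hg)
    (mdifferentiableAt_extChartAt hx)]
  refine vecDeriv_congr ?_ u
  filter_upwards [(isOpen_extChartAt_source x₀).mem_nhds hxs] with y hy
  simp only [Function.comp_apply]
  rw [(extChartAt I x₀).left_inv hy]

theorem contDiffOn_comp_extChartAt_symm {W : Type*} [NormedAddCommGroup W] [NormedSpace ℝ W]
    {g : M → W} {N : Set M} (x₀ : M) (hg : ContMDiffOn I 𝓘(ℝ, W) ∞ g N) :
    ContDiffOn ℝ ∞ (g ∘ (extChartAt I x₀).symm)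
      ((extChartAt I x₀).target ∩ (extChartAt I x₀).symm ⁻¹' N) :=
  (hg.comp ((contMDiffOn_extChartAt_symm x₀).mono Set.inter_subset_left)
    fun _ hz => hz.2).contDiffOn

theorem vecDeriv_apply {X W : Type*} [NormedAddCommGroup X] [NormedSpace ℝ X]
    [NormedAddCommGroup W] [NormedSpace ℝ W] {g : M → X →L[ℝ] W} {x : M}
    (hg : MDifferentiableAt I 𝓘(ℝ, X →L[ℝ] W) g x) (v : X) (u : TangentSpace I x) :
    vecDeriv I (fun y => g y v) u = vecDeriv I g u v :=
  vecDeriv_clm_comp (ContinuousLinearMap.apply ℝ W v) hg u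

theorem mdifferentiableAt_apply {X W : Type*} [NormedAddCommGroup X] [NormedSpace ℝ X]
    [NormedAddCommGroup W] [NormedSpace ℝ W] {g : M → X →L[ℝ] W} {x : M}
    (hg : MDifferentiableAt I 𝓘(ℝ, X →L[ℝ] W) g x) (v : X) :
    MDifferentiableAt I 𝓘(ℝ, W) (fun y => g y v) x :=
  (ContinuousLinearMap.apply ℝ W v).mdifferentiableAt.comp x hg

/-- This turns derivative identities on `M` into the hypotheses of
`exists_radial_transport_preserving` at points of the chart target. -/
theorem fderiv_comp_extChartAt_symm_of_mem [I.Boundaryless] {W : Type*} [NormedAddCommGroup W]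
    [NormedSpace ℝ W] {g : M → W} {x₀ : M} {z : E} (hz : z ∈ (extChartAt I x₀).target)
    (hg : MDifferentiableAt I 𝓘(ℝ, W) g ((extChartAt I x₀).symm z))
    (u : TangentSpace I ((extChartAt I x₀).symm z)) :
    DifferentiableAt ℝ (g ∘ (extChartAt I x₀).symm) z ∧
    fderiv ℝ (g ∘ (extChartAt I x₀).symm) z (chartVec I x₀ _ u) = vecDeriv I g u := by
  have hs : (extChartAt I x₀).symm z ∈ (chartAt H x₀).source := by
    rw [← extChartAt_source I]
    exact (extChartAt I x₀).map_target hz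
  have h1 := mdifferentiableAt_comp_extChartAt_symm hs hg
  have h2 := fderiv_comp_extChartAt_symm hs hg u
  rw [(extChartAt I x₀).right_inv hz] at h1 h2
  exact ⟨h1, h2⟩

variable [FiniteDimensional ℝ E] [T2Space M] [FiniteDimensional ℝ F]
  (t : Trivialization F (π F A)) [MemTrivializationAtlas t]

namespace LieAlgebroid

variable (L : LieAlgebroid I F A)

/-- The anchor in a local trivialization of `A` and the chart of `M` around `x₀`. -/
def chartAnchor (x₀ x : M) : F →L[ℝ] E :=
  ((chartVec I x₀ x : TangentSpace I x →ₗ[ℝ] E) ∘ₗ L.anchor x ∘ₗ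
    t.symmₗ ℝ x).toContinuousLinearMap

theorem chartAnchor_apply (x₀ x : M) (f : F) :
    L.chartAnchor t x₀ x f = chartVec I x₀ x (L.anchor x (t.symmₗ ℝ x f)) := rfl

theorem chartAnchor_linearMapAt (x₀ : M) {x : M} (hx : x ∈ t.baseSet) (v : A x) :
    L.chartAnchor t x₀ x (t.linearMapAt ℝ x v) = chartVec I x₀ x (L.anchor x v) := by
  rw [chartAnchor_apply, t.symmₗ_linearMapAt hx]

theorem mem_kernel_iff_chartAnchor {x₀ x : M} (hxt : x ∈ t.baseSet)
    (hx : x ∈ (chartAt H x₀).source) (v : A x) :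
    v ∈ L.kernel x ↔ L.chartAnchor t x₀ x (t.linearMapAt ℝ x v) = 0 := by
  rw [L.chartAnchor_linearMapAt t x₀ hxt, map_eq_zero_iff _ (chartVec_injective hx)]
  rfl

theorem contMDiffOn_chartAnchor [ContMDiffVectorBundle ∞ F A I] (x₀ : M) :
    ContMDiffOn I 𝓘(ℝ, F →L[ℝ] E) ∞ (L.chartAnchor t x₀)
      (t.baseSet ∩ (chartAt H x₀).source) := by
  refine contMDiffOn_clm_of_apply fun f => ?_
  have hU := t.open_baseSet.inter (chartAt H x₀).open_source
  have h1 := contMDiffOn_symm_section (I := I) (A := A) t hU Set.inter_subset_left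
    (contMDiffOn_const (c := f))
  have h2 : ContMDiffOn I (I.prod 𝓘(ℝ, E)) ∞ (fun x => TotalSpace.mk' E (E := TangentSpace I) x
      (L.anchor x (t.symmₗ ℝ x f))) (t.baseSet ∩ (chartAt H x₀).source) :=
    L.contMDiff_anchor.comp_contMDiffOn h1
  rw [(trivializationAt E (TangentSpace I) x₀).contMDiffOn_section_iff hU
    Set.inter_subset_right] at h2
  refine h2.congr fun x hx => ?_
  have hx' : x ∈ (trivializationAt E (TangentSpace I) x₀).baseSet := hx.2
  rw [chartAnchor_apply, chartVec,
    Trivialization.continuousLinearMapAt_apply ℝ,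
    (trivializationAt E (TangentSpace I) x₀).coe_linearMapAt_of_mem hx']

/-- The anchor of a transitive Lie algebroid has local smooth right inverses. -/
theorem exists_chartAnchor_rightInverse [ContMDiffVectorBundle ∞ F A I]
    (hL : L.IsTransitive) {x₀ : M} (hx₀ : x₀ ∈ t.baseSet) :
    ∃ (U : Set M) (σ : M → E →L[ℝ] F), IsOpen U ∧ x₀ ∈ U ∧ U ⊆ t.baseSet ∧
      U ⊆ (chartAt H x₀).source ∧ ContMDiffOn I 𝓘(ℝ, E →L[ℝ] F) ∞ σ U ∧
      ∀ y ∈ U, ∀ v, L.chartAnchor t x₀ y (σ y v) = v := by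
  have hsurj : Function.Surjective (L.chartAnchor t x₀ x₀) := by
    intro v
    obtain ⟨u, rfl⟩ := chartVec_surjective (I := I) (mem_chart_source H x₀) v
    obtain ⟨a, rfl⟩ := hL x₀ u
    exact ⟨t.linearMapAt ℝ x₀ a, L.chartAnchor_linearMapAt t x₀ hx₀ a⟩
  -- A right inverse `S` at `x₀` is corrected nearby by the inverse of `D y`, the anchor at `y`
  -- composed with `S`; `D` is `1` at `x₀`.
  obtain ⟨S, hS⟩ := (L.chartAnchor t x₀ x₀).exists_rightInverse_of_surjective
    (LinearMap.range_eq_top.2 hsurj)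
  let U₀ := t.baseSet ∩ (chartAt H x₀).source
  have hU₀ : IsOpen U₀ := t.open_baseSet.inter (chartAt H x₀).open_source
  let D : M → E →L[ℝ] E := fun y => (L.chartAnchor t x₀ y).comp S
  have hD : ContMDiffOn I 𝓘(ℝ, E →L[ℝ] E) ∞ D U₀ :=
    (L.contMDiffOn_chartAnchor t x₀).clm_comp contMDiffOn_const
  have hDx : D x₀ = 1 := hS
  refine ⟨U₀ ∩ D ⁻¹' {y | IsUnit y}, fun y => S.comp (Ring.inverse (D y)),
    hD.continuousOn.isOpen_inter_preimage hU₀ Units.isOpen, ⟨⟨hx₀, mem_chart_source H x₀⟩, ?_⟩,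
    fun y hy => hy.1.1, fun y hy => hy.1.2, ?_, ?_⟩
  · show IsUnit (D x₀)
    rw [hDx]
    exact isUnit_one
  · refine ContMDiffOn.clm_comp contMDiffOn_const fun y hy => ?_
    obtain ⟨w, hw⟩ := hy.2
    have h0 : ContDiffAt ℝ ∞ Ring.inverse (D y) := by
      rw [← hw]
      exact contDiffAt_ringInverse ℝ w
    exact (h0.contMDiffAt.comp y (hD.contMDiffAt (hU₀.mem_nhds hy.1))).contMDiffWithinAt
  · intro y hy v
    show (D y * Ring.inverse (D y)) v = v
    rw [Ring.mul_inverse_cancel _ hy.2]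
    rfl

end LieAlgebroid

end ChartAnchor

/-! ### The connection defined by the bracket -/

namespace LieAlgebroid

variable {E : Type*} [NormedAddCommGroup E] [NormedSpace ℝ E]
  {H : Type*} [TopologicalSpace H] {I : ModelWithCorners ℝ E H}
  {M : Type*} [TopologicalSpace M] [ChartedSpace H M]
  {F : Type*} [NormedAddCommGroup F] [NormedSpace ℝ F]
  {A : M → Type*} [∀ x, AddCommGroup (A x)] [∀ x, Module ℝ (A x)]
  [∀ x, TopologicalSpace (A x)] [TopologicalSpace (TotalSpace F A)]
  [FiberBundle F A] [VectorBundle ℝ F A]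
  [IsManifold I ∞ M] [FiniteDimensional ℝ E] [T2Space M] [FiniteDimensional ℝ F]
  [ContMDiffVectorBundle ∞ F A I]
  (t : Trivialization F (π F A)) [MemTrivializationAtlas t] (L : LieAlgebroid I F A)

section BracketRep

variable {X Y : Type*} [NormedAddCommGroup X] [NormedSpace ℝ X] [FiniteDimensional ℝ X]
  [NormedAddCommGroup Y] [NormedSpace ℝ Y] [FiniteDimensional ℝ Y]

/-- The brackets of two families of sections, in a local trivialization. -/
def bracketRep (a : X →ₗ[ℝ] Cₛ^∞⟮I; F, A⟯) (b : Y →ₗ[ℝ] Cₛ^∞⟮I; F, A⟯) (x : M) :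
    X →L[ℝ] Y →L[ℝ] F :=
  ((L.bracket.compl₁₂ a b).compr₂ (t.linearMapAt ℝ x ∘ₗ sectionEval x)).toContinuousBilinearMap

theorem bracketRep_apply (a : X →ₗ[ℝ] Cₛ^∞⟮I; F, A⟯) (b : Y →ₗ[ℝ] Cₛ^∞⟮I; F, A⟯) (x : M)
    (v : X) (w : Y) :
    L.bracketRep t a b x v w = t.linearMapAt ℝ x (L.bracket (a v) (b w) x) := rfl

theorem contMDiffOn_bracketRep (a : X →ₗ[ℝ] Cₛ^∞⟮I; F, A⟯) (b : Y →ₗ[ℝ] Cₛ^∞⟮I; F, A⟯) :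
    ContMDiffOn I 𝓘(ℝ, X →L[ℝ] Y →L[ℝ] F) ∞ (L.bracketRep t a b) t.baseSet :=
  contMDiffOn_clm_of_apply fun v => contMDiffOn_clm_of_apply fun w =>
    contMDiffOn_linearMapAt_section t (L.bracket (a v) (b w))

end BracketRep

variable {x₀ : M} (ψ : SmoothBumpFunction I x₀)

variable {ψ} in
theorem mem_of_bump_eq_one {U : Set M} (hψU : tsupport ψ ⊆ U) {x : M} (hx : ψ x = 1) : x ∈ U :=
  hψU (subset_tsupport _ (by simp [hx]))

/-- The chart components, as global functions. -/
def cutCoord (ℓ : E →L[ℝ] ℝ) : C^∞⟮I, M; ℝ⟯ :=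
  ⟨fun y => ψ y • ℓ (extChartAt I x₀ y),
    ψ.contMDiff_smul (ℓ.contMDiff.comp_contMDiffOn contMDiffOn_extChartAt)⟩

theorem dirDeriv_cutCoord (ℓ : E →L[ℝ] ℝ) {x : M} (hx : ∀ᶠ y in 𝓝 x, ψ y = 1)
    (u : TangentSpace I x) : dirDeriv I (cutCoord ψ ℓ) u = ℓ (chartVec I x₀ x u) := by
  have hxs : x ∈ (chartAt H x₀).source :=
    mem_of_bump_eq_one ψ.tsupport_subset_chartAt_source hx.self_of_nhds
  rw [← vecDeriv_extChartAt hxs, ← vecDeriv_clm_comp ℓ (mdifferentiableAt_extChartAt hxs)]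
  refine vecDeriv_congr ?_ u
  filter_upwards [hx] with y hy
  show ψ y • ℓ (extChartAt I x₀ y) = ℓ (extChartAt I x₀ y)
  rw [hy, one_smul]

/-- The anchor is parallel for the connection `v ↦ [s v, ·]`. -/
theorem vecDeriv_chartAnchor
    (hψt : tsupport ψ ⊆ t.baseSet) (ε : F →ₗ[ℝ] Cₛ^∞⟮I; F, A⟯)
    (hε : ∀ f y, ε f y = ψ y • t.symmₗ ℝ y f) (s : E →ₗ[ℝ] Cₛ^∞⟮I; F, A⟯)
    (hs : ∀ v y, ψ y = 1 → chartVec I x₀ y (L.anchor y (s v y)) = v)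
    {x : M} (hx : ∀ᶠ y in 𝓝 x, ψ y = 1) (v : E) (f : F) :
    vecDeriv I (fun y => L.chartAnchor t x₀ y f) (L.anchor x (s v x))
      = L.chartAnchor t x₀ x (L.bracketRep t s ε x v f) := by
  have hx1 := hx.self_of_nhds
  have hxt := mem_of_bump_eq_one hψt hx1
  have hxs : x ∈ (chartAt H x₀).source := mem_of_bump_eq_one ψ.tsupport_subset_chartAt_source hx1
  -- The formula for the anchor of a bracket holds after multiplication by a section; `ε f` serves
  -- as that section and can be cancelled only where it is nonzero.
  by_cases hf : f = 0
  · subst hf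
    simp only [map_zero]
    exact vecDeriv_const _ _
  have hεx : ε f x ≠ 0 := by
    intro h
    apply hf
    rw [hε, hx1, one_smul] at h
    rw [← t.linearMapAt_symmₗ (R := ℝ) hxt f, h, map_zero]
  have hρ : MDifferentiableAt I 𝓘(ℝ, E) (fun y => L.chartAnchor t x₀ y f) x :=
    (((L.contMDiffOn_chartAnchor t x₀).clm_apply contMDiffOn_const).contMDiffAt
      ((t.open_baseSet.inter (chartAt H x₀).open_source).mem_nhds ⟨hxt, hxs⟩)).mdifferentiableAt
      (by simp)
  refine (SeparatingDual.eq_iff_forall_dual_eq (R := ℝ)).2 fun ℓ => ?_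
  have h := L.dirDeriv_anchor_bracket (s v) (ε f) (ε f) (cutCoord ψ ℓ) x
  -- The anchor of `s v` is a coordinate field, so it differentiates a linear coordinate to the
  -- constant `ℓ v`. Only one term of the commutator survives.
  have h0 : dirDeriv I (L.anchorDeriv (s v) (cutCoord ψ ℓ)) (L.anchor x (ε f x)) = 0 := by
    refine (vecDeriv_congr ?_ _).trans (vecDeriv_const (ℓ v) _)
    filter_upwards [hx.eventually_nhds] with y hy
    show dirDeriv I (cutCoord ψ ℓ) (L.anchor y (s v y)) = ℓ v
    rw [dirDeriv_cutCoord ψ ℓ hy, hs v y hy.self_of_nhds]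
  have h1 : dirDeriv I (L.anchorDeriv (ε f) (cutCoord ψ ℓ)) (L.anchor x (s v x))
      = ℓ (vecDeriv I (fun y => L.chartAnchor t x₀ y f) (L.anchor x (s v x))) := by
    rw [← vecDeriv_clm_comp ℓ hρ]
    refine vecDeriv_congr ?_ _
    filter_upwards [hx.eventually_nhds] with y hy
    show dirDeriv I (cutCoord ψ ℓ) (L.anchor y (ε f y)) = ℓ (L.chartAnchor t x₀ y f)
    rw [dirDeriv_cutCoord ψ ℓ hy, hε, hy.self_of_nhds, one_smul, chartAnchor_apply]
  rw [h0, h1, sub_zero, dirDeriv_cutCoord ψ ℓ hx, smul_left_injective ℝ hεx |>.eq_iff] at h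
  rw [← h, bracketRep_apply, L.chartAnchor_linearMapAt t x₀ hxt]

/-- On the kernel of the anchor, the bracket is a derivation for the connection `v ↦ [s v, ·]`. -/
theorem vecDeriv_bracketRep
    (hψt : tsupport ψ ⊆ t.baseSet) (ε : F →ₗ[ℝ] Cₛ^∞⟮I; F, A⟯)
    (hε : ∀ f y, ε f y = ψ y • t.symmₗ ℝ y f) (s : E →ₗ[ℝ] Cₛ^∞⟮I; F, A⟯)
    {x : M} (hx : ∀ᶠ y in 𝓝 x, ψ y = 1) (v : E) {k l : F}
    (hk : L.chartAnchor t x₀ x k = 0) (hl : L.chartAnchor t x₀ x l = 0) :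
    vecDeriv I (fun y => L.bracketRep t ε ε y k l) (L.anchor x (s v x))
        + L.bracketRep t s ε x v (L.bracketRep t ε ε x k l)
      = L.bracketRep t ε ε x (L.bracketRep t s ε x v k) l
        + L.bracketRep t ε ε x k (L.bracketRep t s ε x v l) := by
  have hx1 := hx.self_of_nhds
  have hxt := mem_of_bump_eq_one hψt hx1
  have hxs : x ∈ (chartAt H x₀).source := mem_of_bump_eq_one ψ.tsupport_subset_chartAt_source hx1
  have hεx : ∀ f, ε f x = t.symmₗ ℝ x f := fun f => by rw [hε, hx1, one_smul]
  have hker : ∀ f, L.chartAnchor t x₀ x f = 0 → ε f x ∈ L.kernel x := by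
    intro f hf
    rw [L.mem_kernel_iff_chartAnchor t hxt hxs, hεx, t.linearMapAt_symmₗ hxt, hf]
  -- Bracketing with a section whose value lies in the kernel is pointwise in the other argument.
  -- The inner brackets in the Jacobi identity can thus be replaced by frame sections with the same
  -- value at `x`.
  have hright : ∀ (f : F) (b : Cₛ^∞⟮I; F, A⟯), L.chartAnchor t x₀ x f = 0 →
      L.bracket (ε f) b x = L.bracket (ε f) (ε (t.linearMapAt ℝ x (b x))) x := by
    intro f b hf
    have h := L.bracket_eq_zero_of_right (b := b - ε (t.linearMapAt ℝ x (b x))) (hker f hf) (by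
      rw [ContMDiffSection.coe_sub, Pi.sub_apply, hεx, t.symmₗ_linearMapAt hxt, sub_self])
    rwa [map_sub, ContMDiffSection.coe_sub, Pi.sub_apply, sub_eq_zero] at h
  have hj := congrArg (fun b : Cₛ^∞⟮I; F, A⟯ => t.linearMapAt ℝ x (b x))
    (L.jacobi (s v) (ε k) (ε l))
  simp only [ContMDiffSection.coe_add, Pi.add_apply, map_add] at hj
  rw [L.linearMapAt_bracket t ψ hψt ε hε (s v) (L.bracket (ε k) (ε l)) hx] at hj
  refine hj.trans ?_
  congr 1
  · rw [bracketRep_apply, bracketRep_apply, L.bracket_swap _ (ε l), L.bracket_swap _ (ε l),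
      ContMDiffSection.coe_neg, ContMDiffSection.coe_neg, Pi.neg_apply, Pi.neg_apply,
      hright l (L.bracket (s v) (ε k)) hl]
  · rw [bracketRep_apply, hright k (L.bracket (s v) (ε l)) hk]
    rfl

end LieAlgebroid

/-! ### Local Lie isomorphisms between the fibres of the kernel -/

namespace LieAlgebroid

variable {E : Type*} [NormedAddCommGroup E] [NormedSpace ℝ E]
  {H : Type*} [TopologicalSpace H] {I : ModelWithCorners ℝ E H}
  {M : Type*} [TopologicalSpace M] [ChartedSpace H M]
  {F : Type*} [NormedAddCommGroup F] [NormedSpace ℝ F]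
  {A : M → Type*} [∀ x, AddCommGroup (A x)] [∀ x, Module ℝ (A x)]
  [∀ x, TopologicalSpace (A x)] [TopologicalSpace (TotalSpace F A)]
  [FiberBundle F A] [VectorBundle ℝ F A]
  [IsManifold I ∞ M] [FiniteDimensional ℝ E] [T2Space M] [FiniteDimensional ℝ F]
  [ContMDiffVectorBundle ∞ F A I]
  (t : Trivialization F (π F A)) [MemTrivializationAtlas t] (L : LieAlgebroid I F A)

/-- Around each point, a transitive Lie algebroid has smooth local automorphisms of its model fibre
that preserve the anchor and the bracket on the kernel of the anchor. -/
theorem exists_kernel_transport [I.Boundaryless] (hL : L.IsTransitive) {x₀ : M}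
    (hx₀ : x₀ ∈ t.baseSet) :
    ∃ (ψ : SmoothBumpFunction I x₀) (ε : F →ₗ[ℝ] Cₛ^∞⟮I; F, A⟯) (U : Set M) (Ψ : M → F →L[ℝ] F),
      (∀ f y, ε f y = ψ y • t.symmₗ ℝ y f) ∧
      IsOpen U ∧ x₀ ∈ U ∧ U ⊆ t.baseSet ∧ U ⊆ (chartAt H x₀).source ∧ (∀ y ∈ U, ψ y = 1) ∧
      ContMDiffOn I 𝓘(ℝ, F →L[ℝ] F) ∞ Ψ U ∧ ∀ y ∈ U, IsUnit (Ψ y) ∧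
        (∀ f, L.chartAnchor t x₀ y (Ψ y f) = L.chartAnchor t x₀ x₀ f) ∧
        ∀ k l, L.chartAnchor t x₀ x₀ k = 0 → L.chartAnchor t x₀ x₀ l = 0 →
          L.bracketRep t ε ε y (Ψ y k) (Ψ y l) = Ψ y (L.bracketRep t ε ε x₀ k l) := by
  obtain ⟨U, σ, hU, hxU, hUt, hUs, hσ, hσr⟩ := L.exists_chartAnchor_rightInverse t hL hx₀
  obtain ⟨ψ, -, hψ⟩ := (SmoothBumpFunction.nhds_basis_tsupport (I := I) x₀).mem_iff.1
    (hU.mem_nhds hxU)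
  have hψt := hψ.trans hUt
  let s : E →ₗ[ℝ] Cₛ^∞⟮I; F, A⟯ := frameSection t hU hUt ψ hψ hσ
  let ε : F →ₗ[ℝ] Cₛ^∞⟮I; F, A⟯ := frameSection t hU hUt ψ hψ
    (contMDiffOn_const (c := ContinuousLinearMap.id ℝ F))
  have hε : ∀ f y, ε f y = ψ y • t.symmₗ ℝ y f := fun f y => rfl
  have hs : ∀ v y, ψ y = 1 → chartVec I x₀ y (L.anchor y (s v y)) = v := by
    intro v y hy
    have hyU := mem_of_bump_eq_one hψ hy
    rw [frameSection_apply, hy, one_smul, ← chartAnchor_apply, hσr y hyU]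
  let χ := extChartAt I x₀
  -- The interior of the set where `ψ` is `1`: the derivative identities need the cutoff to be
  -- constant near the point.
  let N : Set M := {x | ∀ᶠ y in 𝓝 x, ψ y = 1}
  have hN : IsOpen N := isOpen_setOfPred_eventually_nhds
  have hx₀N : x₀ ∈ N := ψ.eventuallyEq_one
  have hNs : N ⊆ (chartAt H x₀).source := fun x hx => hUs (mem_of_bump_eq_one hψ hx.self_of_nhds)
  have hNt : N ⊆ t.baseSet := fun x hx => hUt (mem_of_bump_eq_one hψ hx.self_of_nhds)
  let O : Set E := χ.target ∩ χ.symm ⁻¹' N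
  have hO : IsOpen O :=
    (continuousOn_extChartAt_symm x₀).isOpen_inter_preimage (isOpen_extChartAt_target x₀) hN
  have hz₀ : χ x₀ ∈ O := by
    refine ⟨mem_extChartAt_target x₀, ?_⟩
    show χ.symm (χ x₀) ∈ N
    rwa [χ.left_inv (mem_extChartAt_source x₀)]
  have hmd : ∀ z ∈ O, MDifferentiableAt I 𝓘(ℝ, F →L[ℝ] E) (L.chartAnchor t x₀) (χ.symm z) :=
    fun z hz => ((L.contMDiffOn_chartAnchor t x₀).contMDiffAt
      ((t.open_baseSet.inter (chartAt H x₀).open_source).mem_nhds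
        ⟨hNt hz.2, hNs hz.2⟩)).mdifferentiableAt (by simp)
  have hmc : ∀ z ∈ O, MDifferentiableAt I 𝓘(ℝ, F →L[ℝ] F →L[ℝ] F) (L.bracketRep t ε ε) (χ.symm z) :=
    fun z hz => ((L.contMDiffOn_bracketRep t ε ε).contMDiffAt
      (t.open_baseSet.mem_nhds (hNt hz.2))).mdifferentiableAt (by simp)
  have hsv : ∀ z ∈ O, ∀ v, chartVec I x₀ (χ.symm z) (L.anchor (χ.symm z) (s v (χ.symm z))) = v :=
    fun z hz v =>
      hs v _ (show ∀ᶠ y in 𝓝 (χ.symm z), ψ y = 1 from hz.2).self_of_nhds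
  -- By `hsv` the direction `v` in the chart is the anchor of `s v`, so the ordinary derivative
  -- along `v` is the one in the two parallelism identities.
  obtain ⟨δ, hδ, hball, Ψ, hΨ, hΨz⟩ := exists_radial_transport_preserving hO hz₀
    (Γ := L.bracketRep t s ε ∘ χ.symm) (ρ := L.chartAnchor t x₀ ∘ χ.symm)
    (c := L.bracketRep t ε ε ∘ χ.symm)
    (contDiffOn_comp_extChartAt_symm x₀ ((L.contMDiffOn_bracketRep t s ε).mono hNt))
    (fun z hz => (fderiv_comp_extChartAt_symm_of_mem hz.1 (hmd z hz) 0).1)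
    (fun z hz v f => by
      have h := (fderiv_comp_extChartAt_symm_of_mem hz.1 (hmd z hz)
        (L.anchor (χ.symm z) (s v (χ.symm z)))).2
      rw [hsv z hz] at h
      rw [h, ← vecDeriv_apply (hmd z hz)]
      exact L.vecDeriv_chartAnchor t ψ hψt ε hε s hs hz.2 v f)
    (fun z hz => (fderiv_comp_extChartAt_symm_of_mem (W := F →L[ℝ] F →L[ℝ] F)
      hz.1 (hmc z hz) 0).1)
    (fun z hz v k l hk hl => by
      have h := (fderiv_comp_extChartAt_symm_of_mem (W := F →L[ℝ] F →L[ℝ] F) hz.1 (hmc z hz)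
        (L.anchor (χ.symm z) (s v (χ.symm z)))).2
      rw [hsv z hz] at h
      rw [h, ← vecDeriv_apply (hmc z hz), ← vecDeriv_apply (mdifferentiableAt_apply (hmc z hz) k)]
      exact L.vecDeriv_bracketRep t ψ hψt ε hε s hz.2 v hk hl)
  have hχ : ContMDiffOn I 𝓘(ℝ, E) ∞ χ χ.source := by
    have h := contMDiffOn_extChartAt (I := I) (n := ∞) (x := x₀)
    rwa [← extChartAt_source I] at h
  have hback : ∀ y ∈ χ.source ∩ χ ⁻¹' Metric.ball (χ x₀) δ, y ∈ N := by
    intro y hy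
    have h := (hball hy.2).2
    rw [Set.mem_preimage, χ.left_inv hy.1] at h
    exact h
  refine ⟨ψ, ε, χ.source ∩ χ ⁻¹' Metric.ball (χ x₀) δ, Ψ ∘ χ, hε,
    (continuousOn_extChartAt x₀).isOpen_inter_preimage (isOpen_extChartAt_source x₀)
      Metric.isOpen_ball, ⟨mem_extChartAt_source x₀, Metric.mem_ball_self hδ⟩,
    fun y hy => hNt (hback y hy), fun y hy => hNs (hback y hy),
    fun y hy => (hback y hy).self_of_nhds,
    hΨ.contMDiffOn.comp (hχ.mono Set.inter_subset_left) fun y hy => hy.2, fun y hy => ?_⟩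
  have h := hΨz (χ y) hy.2
  simp only [Function.comp_apply, χ.left_inv hy.1, χ.left_inv (mem_extChartAt_source x₀)] at h
  exact h

/-- Around each point, the fibres of the kernel of the anchor of a transitive Lie algebroid are
isomorphic, by isomorphisms that are smooth in a local trivialization. -/
theorem exists_kernel_lieEquiv [I.Boundaryless] (hL : L.IsTransitive) {x₀ : M}
    (hx₀ : x₀ ∈ t.baseSet) :
    ∃ (U : Set M) (Ψ : M → F →L[ℝ] F), IsOpen U ∧ x₀ ∈ U ∧ U ⊆ t.baseSet ∧
      ContMDiffOn I 𝓘(ℝ, F →L[ℝ] F) ∞ Ψ U ∧ ∀ y ∈ U, IsUnit (Ψ y) ∧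
        ∃ Θ : L.kernel x₀ ≃ₗ⁅ℝ⁆ L.kernel y, ∀ v : L.kernel x₀,
          t.linearMapAt ℝ y (Θ v : A y) = Ψ y (t.linearMapAt ℝ x₀ (v : A x₀)) := by
  obtain ⟨ψ, ε, U, Ψ, hε, hU, hxU, hUt, hUs, hψ, hΨ, h⟩ := L.exists_kernel_transport t hL hx₀
  refine ⟨U, Ψ, hU, hxU, hUt, hΨ, fun y hy => ⟨(h y hy).1, ?_⟩⟩
  obtain ⟨hu, hρ, hc⟩ := h y hy
  have hbr : ∀ y ∈ U, ∀ v w : L.kernel y, t.linearMapAt ℝ y ((⁅v, w⁆ : L.kernel y) : A y)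
      = L.bracketRep t ε ε y (t.linearMapAt ℝ y (v : A y)) (t.linearMapAt ℝ y (w : A y)) := by
    intro y hy v w
    have he : ∀ v : A y, ε (t.linearMapAt ℝ y v) y = v := fun v => by
      rw [hε, hψ y hy, one_smul, t.symmₗ_linearMapAt (hUt hy)]
    rw [L.kernel_bracket v w _ _ (he v) (he w), bracketRep_apply]
  have hmem : ∀ y ∈ U, ∀ v : A y,
      v ∈ L.kernel y ↔ L.chartAnchor t x₀ y (t.linearMapAt ℝ y v) = 0 :=
    fun y hy v => L.mem_kernel_iff_chartAnchor t (hUt hy) (hUs hy) v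
  have hT : ∀ f, t.linearMapAt ℝ y (t.symmₗ ℝ y f) = f := t.linearMapAt_symmₗ (hUt hy)
  have hinj : ∀ v w : A y, t.linearMapAt ℝ y v = t.linearMapAt ℝ y w → v = w := by
    intro v w hvw
    rw [← t.symmₗ_linearMapAt (R := ℝ) (hUt hy) v, hvw, t.symmₗ_linearMapAt (hUt hy)]
  have hmap : ∀ v : L.kernel x₀,
      t.symmₗ ℝ y (Ψ y (t.linearMapAt ℝ x₀ (v : A x₀))) ∈ L.kernel y := by
    intro v
    rw [hmem y hy, hT, hρ, ← hmem x₀ hxU]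
    exact v.2
  let θ : L.kernel x₀ →ₗ⁅ℝ⁆ L.kernel y :=
    { toFun := fun v => ⟨t.symmₗ ℝ y (Ψ y (t.linearMapAt ℝ x₀ (v : A x₀))), hmap v⟩
      map_add' := fun v w => Subtype.ext (by simp)
      map_smul' := fun r v => Subtype.ext (by simp)
      map_lie' := fun {v w} => by
        apply Subtype.ext
        apply hinj
        rw [hbr y hy, hT, hT, hT, hbr x₀ hxU]
        exact (hc _ _ ((hmem x₀ hxU _).1 v.2) ((hmem x₀ hxU _).1 w.2)).symm }
  have hθ : ∀ v : L.kernel x₀, t.linearMapAt ℝ y (θ v : A y) = Ψ y (t.linearMapAt ℝ x₀ (v : A x₀)) :=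
    fun v => hT _
  obtain ⟨w, hw⟩ := hu
  have hw1 : ∀ f, Ψ y ((↑w⁻¹ : F →L[ℝ] F) f) = f := fun f => by
    rw [← hw]
    exact congrArg (fun g : F →L[ℝ] F => g f) w.mul_inv
  have hw2 : ∀ f, (↑w⁻¹ : F →L[ℝ] F) (Ψ y f) = f := fun f => by
    rw [← hw]
    exact congrArg (fun g : F →L[ℝ] F => g f) w.inv_mul
  refine ⟨LieEquiv.ofBijective θ ⟨fun v v' hvv => ?_, fun a => ?_⟩, hθ⟩
  · have h1 : Ψ y (t.linearMapAt ℝ x₀ (v : A x₀)) = Ψ y (t.linearMapAt ℝ x₀ (v' : A x₀)) := by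
      rw [← hθ, ← hθ, hvv]
    have h2 := congrArg (↑w⁻¹ : F →L[ℝ] F) h1
    rw [hw2, hw2] at h2
    apply Subtype.ext
    rw [← t.symmₗ_linearMapAt (R := ℝ) hx₀ (v : A x₀), h2, t.symmₗ_linearMapAt hx₀]
  -- Surjectivity: since `Ψ y` carries the anchor at `x₀` to that at `y`, its inverse carries the
  -- kernel back.
  · have ha : t.symmₗ ℝ x₀ ((↑w⁻¹ : F →L[ℝ] F) (t.linearMapAt ℝ y (a : A y))) ∈ L.kernel x₀ := by
      rw [hmem x₀ hxU, t.linearMapAt_symmₗ hx₀, ← hρ, hw1, ← hmem y hy]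
      exact a.2
    refine ⟨⟨_, ha⟩, ?_⟩
    apply Subtype.ext
    apply hinj
    rw [hθ, t.linearMapAt_symmₗ hx₀, hw1]

end LieAlgebroid

/-! ### Transfer of a Lie bracket to the model fibre -/

/-- The Lie algebra on a vector space that makes a linear equivalence with a Lie algebra an
isomorphism. -/
def LieModel {V 𝔨 : Type*} [AddCommGroup V] [Module ℝ V] [LieRing 𝔨] [LieAlgebra ℝ 𝔨]
    (_ : V ≃ₗ[ℝ] 𝔨) : Type _ := V

namespace LieModel

variable {V 𝔨 : Type*} [AddCommGroup V] [Module ℝ V] [LieRing 𝔨] [LieAlgebra ℝ 𝔨]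
  (e : V ≃ₗ[ℝ] 𝔨)

instance : AddCommGroup (LieModel e) := inferInstanceAs (AddCommGroup V)

instance : Module ℝ (LieModel e) := inferInstanceAs (Module ℝ V)

/-- The identification of the vector space with the Lie algebra. -/
def of : V ≃ₗ[ℝ] LieModel e := LinearEquiv.refl ℝ V

/-- The given linear equivalence. -/
def equiv : LieModel e ≃ₗ[ℝ] 𝔨 := e

instance : Bracket (LieModel e) (LieModel e) := ⟨fun v w => (equiv e).symm ⁅equiv e v, equiv e w⁆⟩

theorem equiv_lie (v w : LieModel e) : equiv e ⁅v, w⁆ = ⁅equiv e v, equiv e w⁆ :=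
  (equiv e).apply_symm_apply _

instance : LieRing (LieModel e) where
  add_lie u v w := (equiv e).injective (by simp only [equiv_lie, map_add, add_lie])
  lie_add u v w := (equiv e).injective (by simp only [equiv_lie, map_add, lie_add])
  lie_self u := (equiv e).injective (by simp only [equiv_lie, lie_self, map_zero])
  leibniz_lie u v w := (equiv e).injective (by
    simp only [equiv_lie, map_add]
    exact leibniz_lie _ _ _)

instance : LieAlgebra ℝ (LieModel e) where
  lie_smul r v w := (equiv e).injective (by simp only [equiv_lie, map_smul, lie_smul])

/-- The given linear equivalence as an isomorphism of Lie algebras. -/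
def lieEquiv : LieModel e ≃ₗ⁅ℝ⁆ 𝔨 := { equiv e with map_lie' := fun {v w} => equiv_lie e v w }

end LieModel

/-! ### Global comparison of the fibres and charts of the kernel -/

namespace LieAlgebroid

variable {E : Type*} [NormedAddCommGroup E] [NormedSpace ℝ E]
  {H : Type*} [TopologicalSpace H] {I : ModelWithCorners ℝ E H}
  {M : Type*} [TopologicalSpace M] [ChartedSpace H M]
  {F : Type*} [NormedAddCommGroup F] [NormedSpace ℝ F]
  {A : M → Type*} [∀ x, AddCommGroup (A x)] [∀ x, Module ℝ (A x)]
  [∀ x, TopologicalSpace (A x)] [TopologicalSpace (TotalSpace F A)]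
  [FiberBundle F A] [VectorBundle ℝ F A]
  [IsManifold I ∞ M] [FiniteDimensional ℝ E] [T2Space M] [FiniteDimensional ℝ F]
  [ContMDiffVectorBundle ∞ F A I] [I.Boundaryless] (L : LieAlgebroid I F A)

/-- The fibres of the kernel of the anchor of a transitive Lie algebroid over a connected manifold
are isomorphic Lie algebras. -/
theorem nonempty_kernel_lieEquiv [ConnectedSpace M] (hL : L.IsTransitive) (x y : M) :
    Nonempty (L.kernel x ≃ₗ⁅ℝ⁆ L.kernel y) := by
  have hloc : ∀ y : M, ∀ᶠ z in 𝓝 y, Nonempty (L.kernel y ≃ₗ⁅ℝ⁆ L.kernel z) := by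
    intro y
    obtain ⟨U, Ψ, hU, hy, -, -, h⟩ := L.exists_kernel_lieEquiv (trivializationAt F A y) hL
      (FiberBundle.mem_baseSet_trivializationAt F A y)
    filter_upwards [hU.mem_nhds hy] with z hz
    exact ⟨(h z hz).2.choose⟩
  let S : Set M := {y | Nonempty (L.kernel x ≃ₗ⁅ℝ⁆ L.kernel y)}
  -- The isomorphism class of the fibre is locally constant, so both `S` and its complement are
  -- open.
  have hS : IsClopen S := by
    refine ⟨⟨isOpen_iff_mem_nhds.2 fun y hy => ?_⟩, isOpen_iff_mem_nhds.2 fun y hy => ?_⟩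
    · filter_upwards [hloc y] with z hz hzS
      exact hy (hzS.elim fun f => hz.elim fun g => ⟨f.trans g.symm⟩)
    · filter_upwards [hloc y] with z hz
      exact hy.elim fun f => hz.elim fun g => ⟨f.trans g⟩
  have huniv := hS.eq_univ ⟨x, ⟨LieEquiv.refl⟩⟩
  exact (huniv ▸ Set.mem_univ y : y ∈ S)

/-- The kernel of the anchor of a transitive Lie algebroid has local charts by isomorphisms of
Lie algebras. -/
theorem exists_subbundleChart (hL : L.IsTransitive) {V 𝔨 : Type*} [NormedAddCommGroup V]
    [NormedSpace ℝ V] [FiniteDimensional ℝ V] [LieRing 𝔨] [LieAlgebra ℝ 𝔨] (e : V ≃ₗ[ℝ] 𝔨)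
    {x₀ : M} (g : 𝔨 ≃ₗ⁅ℝ⁆ L.kernel x₀) :
    ∃ c : SubbundleChart I F V L.kernel, x₀ ∈ c.U ∧ ∀ y ∈ c.U, ∃ Φ : L.kernel y ≃ₗ⁅ℝ⁆ 𝔨,
      ∀ v : L.kernel y, c.β y (c.triv ⟨y, (v : A y)⟩).2 = e.symm (Φ v) := by
  let t := trivializationAt F A x₀
  have hx₀ : x₀ ∈ t.baseSet := FiberBundle.mem_baseSet_trivializationAt F A x₀
  obtain ⟨U, Ψ, hU, hxU, hUt, hΨ, h⟩ := L.exists_kernel_lieEquiv t hL hx₀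
  -- `ι` embeds the model as the kernel at `x₀`. The chart has `α = Ψ ι` and `β = p Ψ⁻¹`; any linear
  -- left inverse `p` of `ι` will do, since `α β` has to be the identity on the kernel only.
  let ι : V →ₗ[ℝ] F := t.linearMapAt ℝ x₀ ∘ₗ (L.kernel x₀).subtype ∘ₗ
    (g : 𝔨 →ₗ[ℝ] L.kernel x₀) ∘ₗ (e : V →ₗ[ℝ] 𝔨)
  have hι : ∀ w, ι w = t.linearMapAt ℝ x₀ (g (e w) : A x₀) := fun w => rfl
  have hιinj : Function.Injective ι := by
    intro v w hvw
    rw [hι, hι] at hvw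
    have h1 : (g (e v) : A x₀) = g (e w) := by
      rw [← t.symmₗ_linearMapAt (R := ℝ) hx₀ (g (e v) : A x₀), hvw, t.symmₗ_linearMapAt hx₀]
    exact e.injective (g.injective (Subtype.ext h1))
  obtain ⟨p, hp⟩ := ι.exists_leftInverse_of_injective (LinearMap.ker_eq_bot.2 hιinj)
  have hpι : ∀ w, p (ι w) = w := fun w => congrArg (fun q : V →ₗ[ℝ] V => q w) hp
  choose hu Θ hΘ using fun y (hy : y ∈ U) => h y hy
  have hΨι : ∀ y (hy : y ∈ U) w, Ψ y (ι w) = t.linearMapAt ℝ y (Θ y hy (g (e w)) : A y) :=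
    fun y hy w => (hΘ y hy (g (e w))).symm
  have hinv : ∀ y, y ∈ U → ∀ f, Ring.inverse (Ψ y) (Ψ y f) = f := fun y hy f =>
    congrArg (fun q : F →L[ℝ] F => q f) (Ring.inverse_mul_cancel _ (hu y hy))
  have hcoord : ∀ y (hy : y ∈ U) (v : L.kernel y),
      (t ⟨y, (v : A y)⟩).2 = Ψ y (ι (e.symm (g.symm ((Θ y hy).symm v)))) := by
    intro y hy v
    rw [hΨι y hy, e.apply_symm_apply, g.apply_symm_apply, LieEquiv.apply_symm_apply,
      t.coe_linearMapAt_of_mem (hUt hy)]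
  have hβ : ∀ y (hy : y ∈ U) (v : L.kernel y),
      p (Ring.inverse (Ψ y) (t ⟨y, (v : A y)⟩).2) = e.symm (g.symm ((Θ y hy).symm v)) := by
    intro y hy v
    rw [hcoord y hy, hinv y hy, hpι]
  let c : SubbundleChart I F V L.kernel :=
    { triv := t
      U := U
      α := fun y => (Ψ y).comp ι.toContinuousLinearMap
      β := fun y => p.toContinuousLinearMap.comp (Ring.inverse (Ψ y))
      memAtlas := inferInstance
      isOpen := hU
      subset := hUt
      contMDiffOn_α := hΨ.clm_comp contMDiffOn_const
      contMDiffOn_β := by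
        refine ContMDiffOn.clm_comp contMDiffOn_const fun y hy => ?_
        obtain ⟨w, hw⟩ := hu y hy
        have h0 : ContDiffAt ℝ ∞ Ring.inverse (Ψ y) := by
          rw [← hw]
          exact contDiffAt_ringInverse ℝ w
        exact (h0.contMDiffAt.comp y (hΨ.contMDiffAt (hU.mem_nhds hy))).contMDiffWithinAt
      mem := fun y hy w => by
        show t.symm y (Ψ y (ι w)) ∈ L.kernel y
        rw [← t.symmₗ_apply (R := ℝ) (hUt hy), hΨι y hy, t.symmₗ_linearMapAt (hUt hy)]
        exact (Θ y hy (g (e w))).2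
      β_α := fun y hy w => by
        show p (Ring.inverse (Ψ y) (Ψ y (ι w))) = w
        rw [hinv y hy, hpι]
      α_β := fun y hy v hv => by
        show Ψ y (ι (p (Ring.inverse (Ψ y) (t ⟨y, v⟩).2))) = (t ⟨y, v⟩).2
        rw [hβ y hy ⟨v, hv⟩]
        exact (hcoord y hy ⟨v, hv⟩).symm }
  exact ⟨c, hxU, fun y hy => ⟨(Θ y hy).symm.trans g.symm, hβ y hy⟩⟩

end LieAlgebroid

end

theorem theorem4p3
    {E : Type*} [NormedAddCommGroup E] [NormedSpace ℝ E] [FiniteDimensional ℝ E]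
    {M : Type*} [TopologicalSpace M] [ChartedSpace E M] [IsManifold 𝓘(ℝ, E) ∞ M]
    [T2Space M] [ConnectedSpace M]
    {F : Type*} [NormedAddCommGroup F] [NormedSpace ℝ F] [FiniteDimensional ℝ F]
    {A : M → Type*} [∀ x, AddCommGroup (A x)] [∀ x, Module ℝ (A x)]
    [∀ x, TopologicalSpace (A x)] [TopologicalSpace (TotalSpace F A)]
    [FiberBundle F A] [VectorBundle ℝ F A] [ContMDiffVectorBundle ∞ F A 𝓘(ℝ, E)]
    (L : LieAlgebroid 𝓘(ℝ, E) F A) (hL : L.IsTransitive) :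
    (∃ (r : ℕ) (_ : TopologicalSpace (TotalSpace (Fin r → ℝ) (fun x => L.kernel x)))
        (_ : FiberBundle (Fin r → ℝ) (fun x => L.kernel x))
        (_ : VectorBundle ℝ (Fin r → ℝ) (fun x => L.kernel x)),
      ContMDiff (𝓘(ℝ, E).prod 𝓘(ℝ, Fin r → ℝ)) (𝓘(ℝ, E).prod 𝓘(ℝ, F)) ∞
          (L.kernelIncl (Fin r → ℝ)) ∧
        Topology.IsEmbedding (L.kernelIncl (Fin r → ℝ)) ∧
        IsLieAlgebraBundle 𝓘(ℝ, E) (Fin r → ℝ) (fun x => L.kernel x)) ∧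
      ∀ x y : M, Nonempty (L.kernel x ≃ₗ⁅ℝ⁆ L.kernel y) := by
  refine ⟨?_, L.nonempty_kernel_lieEquiv hL⟩
  obtain ⟨x₁⟩ : Nonempty M := inferInstance
  let t := trivializationAt F A x₁
  have hx₁ : x₁ ∈ t.baseSet := FiberBundle.mem_baseSet_trivializationAt F A x₁
  have : FiniteDimensional ℝ (A x₁) := (t.linearEquivAt ℝ x₁ hx₁).symm.finiteDimensional
  let r := Module.finrank ℝ (L.kernel x₁)
  let e : (Fin r → ℝ) ≃ₗ[ℝ] L.kernel x₁ := (Module.finBasis ℝ (L.kernel x₁)).equivFun.symm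
  -- All charts use the same identification `e` with the fibre at `x₁`, so that one Lie algebra
  -- serves every point.
  have hch := fun x => L.exists_subbundleChart hL e (L.nonempty_kernel_lieEquiv hL x₁ x).some
  choose c hc Φ hΦ using hch
  -- With the topology induced from `A`, the inclusion is an embedding as soon as it is injective.
  let τ : TopologicalSpace (TotalSpace (Fin r → ℝ) (fun x => L.kernel x)) :=
    TopologicalSpace.induced (L.kernelIncl (Fin r → ℝ)) inferInstance
  have hK : Topology.IsInducing (subbundleIncl F (Fin r → ℝ) :
      TotalSpace (Fin r → ℝ) (fun x => L.kernel x) → TotalSpace F A) := ⟨rfl⟩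
  let fb := SubbundleChart.fiberBundle hK c hc
  let vb := SubbundleChart.vectorBundle hK c hc
  have sb := SubbundleChart.contMDiffVectorBundle hK c hc
  -- The Lie algebra must lie in the universe of the model fibre, so the bracket of the fibre at
  -- `x₁` is moved to `Fin r → ℝ` by `LieModel`.
  refine ⟨r, τ, fb, vb, SubbundleChart.contMDiff_subbundleIncl hK c hc,
    ⟨hK, injective_subbundleIncl F (Fin r → ℝ)⟩, sb, LieModel e, inferInstance, inferInstance,
    fun x₀ => ?_⟩
  let T := (c x₀).trivialization hK
  have : MemTrivializationAtlas T := ⟨⟨x₀, rfl⟩⟩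
  refine ⟨T, LieModel.of e, hc x₀, T.contMDiffOn, T.contMDiffOn_symm, fun y hy =>
    ⟨(Φ x₀ y hy).trans (LieModel.lieEquiv e).symm, fun v => ?_⟩⟩
  exact congrArg (LieModel.of e) (hΦ x₀ y hy v)
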